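/- Let $\ell>0$ and $R>0$, and consider fields $w=(u,v)$ on the strip $\mathbb R\times[0,1]$ that are $\ell$-periodic in $x$. Let $X$ be the closure in $L_2(\Omega;\mathbb C^2)$, $\Omega=[0,\ell]\times[0,1]$, of the smooth $\ell$-periodic divergence-free fields $(u,v)$ with $v=0$ on the walls $y=0,1$ and with no net flux, $\int_0^1u\,dy=0$ (i.e. the fields $(-\psi_y,\psi_x)$ of a periodic stream function $\psi$ vanishing on both walls). Let $W=(y,0)$ and let $\mathcal L_R$ be the closed operator in $X$ obtained as the closure of $$\mathcal L_Rw=\tfrac1R\Delta w-(w\cdot\nabla)W-(W\cdot\nabla)w-\nabla p$$ on the smooth fields of this kind with $w=0$ on the walls, where $p$ is smooth, has $\ell$-periodic gradient, solves $\Delta p=-\nabla\cdot((w\cdot\nabla)W)-\nabla\cdot((W\cdot\nabla)w)$ with $p_y=\tfrac1Rv_{yy}$ at $y=0,1$, and has the mean pressure gradient for which $\mathcal L_Rw$ has no net flux. Let $C\ge0$ and let $s\in\mathbb C$ satisfy $|s|<2\sqrt2(1+\sqrt R)$. Write $\|f\|^2=\int_0^1|f|^2\,dy$ and $\kappa=2\pi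 k/\ell$ for $k\in\mathbb Z$. Suppose that for every $k\in\mathbb Z$, for all smooth $\widehat F,\widehat G:[0,1]\to\mathbb C$ with $i\kappa\widehat F+\widehat G'=0$, $\widehat G(0)=\widehat G(1)=0$, $\int_0^1\widehat F\,dy=0$, every smooth solution $\widehat\psi$ of $$\tfrac1R\widehat\psi''''-\Big(s+\tfrac{2\kappa^2}R+i\kappa y\Big)\widehat\psi''+\Big(s\kappa^2+\tfrac{\kappa^4}R+i\kappa^3y\Big)\widehat\psi=\widehat F'-i\kappa\widehat G,\qquad \widehat\psi(0)=\widehat\psi(1)=\widehat\psi'(0)=\widehat\psi'(1)=0,$$ satisfies $$\kappa^2\|\widehat\psi\|^2\le CR^2(\|\widehat F\|^2+\|\widehat G\|^2),\qquad \|\widehat\psi'\|^2\le CR^2(\|\widehat F\|^2+\|\widehat G\|^2).$$ Then $(s\mathcal I-\mathcal L_R)^{-1}$ exists as a bounded operator on all of $X$, and $$\|(s\mathcal I-\mathcal L_R)^{-1}\|^2\le 2CR^2 .$$ In particular, if the estimates hold for all $s$ in a subset of the disc $|s|<2\sqrt2(1+\sqrt R)$ (such as its part in $\operatorname{Re}s\ge0$),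 then the resolvent bound holds on that subset. -/

import Mathlib

open MeasureTheory
open scoped ContDiff

noncomputable section

namespace Couette

/-! Points of the strip are pairs `z = (x, y)`; the strip is `y ∈ [0, 1]`, and every field is periodic
in `x` with period `ℓ`. Smooth functions on the closed strip are represented by smooth functions on
the plane, and all equations are imposed on the strip only. -/

/-- The partial derivative in `x`. -/
def dx (f : ℝ × ℝ → ℂ) (z : ℝ × ℝ) : ℂ := fderiv ℝ f z (1, 0)

/-- The partial derivative in `y`. -/
def dy (f : ℝ × ℝ → ℂ) (z : ℝ × ℝ) : ℂ := fderiv ℝ f z (0, 1)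

/-- The Laplacian. -/
def lap (f : ℝ × ℝ → ℂ) (z : ℝ × ℝ) : ℂ := dx (dx f) z + dy (dy f) z

/-- First component of `(w · ∇) W + (W · ∇) w` for `w = (u, v)` and the Couette flow `W = (y, 0)`. -/
def advU (u v : ℝ × ℝ → ℂ) (z : ℝ × ℝ) : ℂ := v z + (z.2 : ℂ) * dx u z

/-- Second component of `(w · ∇) W + (W · ∇) w` for `w = (u, v)` and the Couette flow `W = (y, 0)`. -/
def advV (v : ℝ × ℝ → ℂ) (z : ℝ × ℝ) : ℂ := (z.2 : ℂ) * dx v z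

/-- First component of `(1/R) Δw - (w · ∇) W - (W · ∇) w - ∇p`. -/
def rhsU (R : ℝ) (u v p : ℝ × ℝ → ℂ) (z : ℝ × ℝ) : ℂ :=
  (1 / R : ℂ) * lap u z - advU u v z - dx p z

/-- Second component of `(1/R) Δw - (w · ∇) W - (W · ∇) w - ∇p`. -/
def rhsV (R : ℝ) (v p : ℝ × ℝ → ℂ) (z : ℝ × ℝ) : ℂ :=
  (1 / R : ℂ) * lap v z - advV v z - dy p z

/-- Smooth, `x`-periodic, divergence free fields `(u, v)` that are tangential to the walls `y = 0, 1`
and have no net flux through the channel; equivalently, the fields `(-ψ_y, ψ_x)` of a smooth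
`x`-periodic stream function `ψ` that vanishes on both walls. -/
structure IsSmoothSolenoidal (ℓ : ℝ) (u v : ℝ × ℝ → ℂ) : Prop where
  smooth_u : ContDiff ℝ ∞ u
  smooth_v : ContDiff ℝ ∞ v
  periodic_u : ∀ x y : ℝ, u (x + ℓ, y) = u (x, y)
  periodic_v : ∀ x y : ℝ, v (x + ℓ, y) = v (x, y)
  div_free : ∀ x : ℝ, ∀ y ∈ Set.Icc (0 : ℝ) 1, dx u (x, y) + dy v (x, y) = 0
  wall_zero : ∀ x : ℝ, v (x, 0) = 0
  wall_one : ∀ x : ℝ, v (x, 1) = 0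
  flux_zero : ∀ x : ℝ, ∫ y in (0 : ℝ)..1, u (x, y) = 0

/-- `p` is a pressure of the velocity field `(u, v)`: it solves the Neumann problem
`Δp = -∇·((w·∇)W) - ∇·((W·∇)w)`, `p_y = v_yy / R` on the walls. Its gradient is periodic, and the mean
pressure gradient `c / ℓ` is the one that keeps the flow without net flux; this determines `p` up to
an additive constant. -/
structure IsPressure (ℓ R : ℝ) (u v p : ℝ × ℝ → ℂ) : Prop where
  smooth : ContDiff ℝ ∞ p
  periodic_grad : ∃ c : ℂ, ∀ x y : ℝ, p (x + ℓ, y) = p (x, y) + c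
  poisson : ∀ x : ℝ, ∀ y ∈ Set.Icc (0 : ℝ) 1,
    lap p (x, y) = -(dx (advU u v) (x, y) + dy (advV v) (x, y))
  wall_zero : ∀ x : ℝ, dy p (x, 0) = (1 / R : ℂ) * dy (dy v) (x, 0)
  wall_one : ∀ x : ℝ, dy p (x, 1) = (1 / R : ℂ) * dy (dy v) (x, 1)
  flux_zero : ∀ x : ℝ, ∫ y in (0 : ℝ)..1, rhsU R u v p (x, y) = 0

/-- Lebesgue measure on the periodicity cell `Ω = [0, ℓ] × [0, 1]`. -/
def cell (ℓ : ℝ) : Measure (ℝ × ℝ) :=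
  (volume : Measure (ℝ × ℝ)).restrict (Set.Icc 0 ℓ ×ˢ Set.Icc 0 1)

/-- The Hilbert space `L₂(Ω; ℂ²)`. -/
abbrev L2 (ℓ : ℝ) := Lp (EuclideanSpace ℂ (Fin 2)) 2 (cell ℓ)

/-- `h ∈ L₂(Ω; ℂ²)` is the class of the vector field `(u, v)`. -/
def Represents (ℓ : ℝ) (h : L2 ℓ) (u v : ℝ × ℝ → ℂ) : Prop :=
  ⇑h =ᵐ[cell ℓ] fun z => !₂[u z, v z]

/-- The state space: the closure in `L₂(Ω; ℂ²)` of the smooth solenoidal fields. -/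
def solenoidal (ℓ : ℝ) : Submodule ℂ (L2 ℓ) :=
  (Submodule.span ℂ
    {h : L2 ℓ | ∃ u v, IsSmoothSolenoidal ℓ u v ∧ Represents ℓ h u v}).topologicalClosure

/-- The graph of the operator `w ↦ (1/R) Δw - (w · ∇) W - (W · ∇) w - ∇p` on the smooth solenoidal
fields `w = (u, v)` that vanish on the walls. -/
def classicalGraph (ℓ R : ℝ) : Set (solenoidal ℓ × solenoidal ℓ) :=
  {q | ∃ u v p, IsSmoothSolenoidal ℓ u v ∧
      (∀ x : ℝ, u (x, 0) = 0) ∧ (∀ x : ℝ, u (x, 1) = 0) ∧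
      IsPressure ℓ R u v p ∧
      Represents ℓ q.1 u v ∧ Represents ℓ q.2 (rhsU R u v p) (rhsV R v p)}

/-- The graph of the operator `L_R`, the closure in `L₂` of the classical operator. -/
def operatorGraph (ℓ R : ℝ) : Set (solenoidal ℓ × solenoidal ℓ) :=
  closure (classicalGraph ℓ R)

/-- `S = (s I - L)⁻¹` for the operator `L` with graph `A`: for all `h`, the vector `w = S h` is the one
and only `w` in the domain of `L` with `s w - L w = h`. -/
def IsResolvent {X : Type*} [NormedAddCommGroup X] [NormedSpace ℂ X]
    (A : Set (X × X)) (s : ℂ) (S : X →L[ℂ] X) : Prop :=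
  ∀ h w : X, S h = w ↔ (w, s • w - h) ∈ A

/-- The wavenumber `2πk/ℓ` of the `k`-th Fourier mode in `x`. -/
def wavenumber (ℓ : ℝ) (k : ℤ) : ℝ := 2 * Real.pi * k / ℓ

/-- `(F, G)` are the coefficients of a single Fourier mode `(F y, G y) e^{iκx}` that is a smooth
solenoidal field. -/
structure IsSolenoidalMode (κ : ℝ) (F G : ℝ → ℂ) : Prop where
  smooth_F : ContDiff ℝ ∞ F
  smooth_G : ContDiff ℝ ∞ G
  div_free : ∀ y ∈ Set.Icc (0 : ℝ) 1, Complex.I * κ * F y + deriv G y = 0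
  wall_zero : G 0 = 0
  wall_one : G 1 = 0
  flux_zero : ∫ y in (0 : ℝ)..1, F y = 0

/-- `ψ` is a solution of the fourth order boundary value problem for the stream function, with
wavenumber `κ`, spectral parameter `s` and forcing `F' - iκG`. -/
structure IsStreamSolution (R κ : ℝ) (s : ℂ) (F G ψ : ℝ → ℂ) : Prop where
  smooth : ContDiff ℝ ∞ ψ
  ode : ∀ y ∈ Set.Icc (0 : ℝ) 1,
    (1 / R : ℂ) * iteratedDeriv 4 ψ y
      - (s + 2 * (κ : ℂ) ^ 2 / R + Complex.I * κ * y) * iteratedDeriv 2 ψ y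
      + (s * (κ : ℂ) ^ 2 + (κ : ℂ) ^ 4 / R + Complex.I * (κ : ℂ) ^ 3 * y) * ψ y
      = deriv F y - Complex.I * κ * G y
  zero_zero : ψ 0 = 0
  zero_one : ψ 1 = 0
  deriv_zero : deriv ψ 0 = 0
  deriv_one : deriv ψ 1 = 0

/-- The squared norm `‖f‖² = ∫₀¹ |f|² dy`. -/
def normSq (f : ℝ → ℂ) : ℝ := ∫ y in (0 : ℝ)..1, ‖f y‖ ^ 2

end Couette

end

/-!
Taking the vorticity of `s w - L w = h` removes the pressure, and the `k`-th Fourier coefficient of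
the result in `x` is the Orr–Sommerfeld equation for the stream function of the `k`-th mode of `w`.
The estimates for the modes, summed by Parseval's identity, give `‖w‖² ≤ 2CR²‖h‖²`, so `s I - L_R` is
injective with closed range. It remains to see that its range is dense, i.e. that it contains every
single Fourier mode. The estimates make the homogeneous boundary value problem uniquely solvable,
hence by the Fredholm alternative for two-point problems the Orr–Sommerfeld equation has a solution
for each mode. Its velocity field satisfies the vorticity equation, so the residual of the momentum
equation is curl-free and therefore the gradient of a pressure. That this is the pressure of the
problem amounts to the right-hand side being solenoidal.
-/

noncomputable section

namespace Couette

/-! ### Resolvents of closed linear relations -/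

section Resolvent

variable {X : Type*} [NormedAddCommGroup X] [NormedSpace ℂ X]

theorem norm_fst_le_of_mem_topologicalClosure {A : Submodule ℂ (X × X)} {s : ℂ} {M : ℝ}
    (hA : ∀ q ∈ A, ‖q.1‖ ≤ M * ‖s • q.1 - q.2‖) {q : X × X} (hq : q ∈ A.topologicalClosure) :
    ‖q.1‖ ≤ M * ‖s • q.1 - q.2‖ :=
  closure_minimal (t := {q : X × X | ‖q.1‖ ≤ M * ‖s • q.1 - q.2‖}) hA
    (isClosed_le (by fun_prop) (by fun_prop)) hq

theorem norm_le_mul_norm_smul_fst_sub_snd {s : ℂ} {M : ℝ} {q : X × X}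
    (hq : ‖q.1‖ ≤ M * ‖s • q.1 - q.2‖) :
    ‖q‖ ≤ (M + (‖s‖ * M + 1)) * ‖s • q.1 - q.2‖ := by
  have hfst : 0 ≤ M * ‖s • q.1 - q.2‖ := (norm_nonneg _).trans hq
  have hsnd : ‖q.2‖ ≤ (‖s‖ * M + 1) * ‖s • q.1 - q.2‖ := calc
    ‖q.2‖ = ‖s • q.1 - (s • q.1 - q.2)‖ := by rw [sub_sub_cancel]
    _ ≤ ‖s‖ * ‖q.1‖ + ‖s • q.1 - q.2‖ := (norm_sub_le _ _).trans_eq (by rw [norm_smul])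
    _ ≤ ‖s‖ * (M * ‖s • q.1 - q.2‖) + ‖s • q.1 - q.2‖ := by gcongr
    _ = (‖s‖ * M + 1) * ‖s • q.1 - q.2‖ := by ring
  rw [Prod.norm_def, add_mul]
  exact max_le (by linarith [norm_nonneg q.2]) (by linarith)

theorem exists_mem_topologicalClosure_smul_fst_sub_snd_eq [CompleteSpace X]
    {A : Submodule ℂ (X × X)} {s : ℂ} {M : ℝ} (hM : 0 ≤ M)
    (hA : ∀ q ∈ A, ‖q.1‖ ≤ M * ‖s • q.1 - q.2‖)
    (hd : Dense {h : X | ∃ q ∈ A, s • q.1 - q.2 = h}) (h : X) :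
    ∃ q ∈ A.topologicalClosure, s • q.1 - q.2 = h := by
  have : CompleteSpace A.topologicalClosure := A.isClosed_topologicalClosure.completeSpace_coe
  let T : A.topologicalClosure →L[ℂ] X :=
    (s • ContinuousLinearMap.fst ℂ X X - ContinuousLinearMap.snd ℂ X X).comp
      A.topologicalClosure.subtypeL
  let K : NNReal := ⟨M + (‖s‖ * M + 1), by positivity⟩
  have hanti : AntilipschitzWith K T := T.antilipschitz_of_bound fun q =>
    norm_le_mul_norm_smul_fst_sub_snd (norm_fst_le_of_mem_topologicalClosure hA q.2)
  have hdense : Dense (Set.range T) := hd.mono <| by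
    rintro _ ⟨q, hq, rfl⟩
    exact ⟨⟨q, A.le_topologicalClosure hq⟩, rfl⟩
  have hrange : Set.range T = Set.univ :=
    (hanti.isClosed_range T.uniformContinuous).closure_eq.symm.trans hdense.closure_eq
  obtain ⟨q, hq⟩ := Set.range_eq_univ.mp hrange h
  exact ⟨q, q.2, hq⟩

theorem exists_isResolvent {B : Submodule ℂ (X × X)} {s : ℂ} {M : ℝ} (hM : 0 ≤ M)
    (hB : ∀ q ∈ B, ‖q.1‖ ≤ M * ‖s • q.1 - q.2‖)
    (hsurj : ∀ h, ∃ q ∈ B, s • q.1 - q.2 = h) :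
    ∃ S : X →L[ℂ] X, IsResolvent (B : Set (X × X)) s S ∧ ‖S‖ ≤ M := by
  have unique : ∀ {q r}, q ∈ B → r ∈ B → s • q.1 - q.2 = s • r.1 - r.2 → q.1 = r.1 := by
    intro q r hq hr h
    have hzero : s • (q - r).1 - (q - r).2 = 0 := by
      rw [Prod.fst_sub, Prod.snd_sub, smul_sub, sub_sub_sub_comm, h, sub_self]
    have := hB _ (B.sub_mem hq hr)
    rw [hzero, norm_zero, mul_zero] at this
    exact sub_eq_zero.mp (norm_le_zero_iff.mp this)
  choose Q hQ hQh using hsurj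
  let S : X →ₗ[ℂ] X :=
    { toFun := fun h => (Q h).1
      map_add' := fun g h => unique (hQ _) (B.add_mem (hQ g) (hQ h)) <| by
        rw [hQh, Prod.fst_add, Prod.snd_add, smul_add, add_sub_add_comm, hQh, hQh]
      map_smul' := fun c h => unique (hQ _) (B.smul_mem c (hQ h)) <| by
        rw [hQh, Prod.smul_fst, Prod.smul_snd, smul_comm, ← smul_sub, hQh] }
  refine ⟨S.mkContinuous M fun h => ?_, fun h w => ⟨?_, fun hw => ?_⟩,
    S.mkContinuous_norm_le hM _⟩
  · exact (hB _ (hQ h)).trans_eq (by rw [hQh])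
  · rintro rfl
    have hgraph : ((Q h).1, s • (Q h).1 - h) = Q h :=
      Prod.ext rfl (sub_eq_iff_eq_add.mpr (sub_eq_iff_eq_add'.mp (hQh h)))
    exact (congrArg (· ∈ B) hgraph).mpr (hQ h)
  · exact unique (hQ h) hw (by rw [hQh, sub_sub_cancel])

theorem exists_isResolvent_closure [CompleteSpace X] {A : Submodule ℂ (X × X)} {s : ℂ} {M : ℝ}
    (hM : 0 ≤ M) (hA : ∀ q ∈ A, ‖q.1‖ ≤ M * ‖s • q.1 - q.2‖)
    (hd : Dense {h : X | ∃ q ∈ A, s • q.1 - q.2 = h}) :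
    ∃ S : X →L[ℂ] X, IsResolvent (closure (A : Set (X × X))) s S ∧ ‖S‖ ≤ M :=
  exists_isResolvent hM (fun _ => norm_fst_le_of_mem_topologicalClosure hA)
    (exists_mem_topologicalClosure_smul_fst_sub_snd_eq hM hA hd)

end Resolvent

/-! ### Linear differential equations -/

section LinearODE

variable {E : Type*} [NormedAddCommGroup E] [NormedSpace ℝ E]

/-- The terms of the Picard series, whose sum solves the initial value problem
`Φ' = A Φ + b`, `Φ 0 = x₀`. -/
def picardTerm (A : ℝ → E →L[ℝ] E) (b : ℝ → E) (x₀ : E) : ℕ → ℝ → E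
  | 0, t => x₀ + ∫ τ in (0 : ℝ)..t, b τ
  | n + 1, t => ∫ τ in (0 : ℝ)..t, A τ (picardTerm A b x₀ n τ)

variable {A : ℝ → E →L[ℝ] E} {b : ℝ → E}

theorem continuous_picardTerm (hA : Continuous A) (hb : Continuous b) (x₀ : E) (n : ℕ) :
    Continuous (picardTerm A b x₀ n) := by
  induction n with
  | zero =>
    exact continuous_const.add
      (intervalIntegral.continuous_primitive (fun _ _ => hb.intervalIntegrable _ _) 0)
  | succ n ih =>
    exact intervalIntegral.continuous_primitive
      (fun _ _ => (hA.clm_apply ih).intervalIntegrable _ _) 0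

theorem abs_le_of_mem_uIoc_zero {t τ : ℝ} (hτ : τ ∈ Set.uIoc 0 t) : |τ| ≤ |t| := by
  simpa only [sub_zero] using Set.abs_sub_left_of_mem_uIcc (Set.uIoc_subset_uIcc hτ)

theorem norm_picardTerm_le {x₀ : E} {T K B : ℝ} (hA : Continuous A) (hb : Continuous b)
    (hK : ∀ t, |t| ≤ T → ‖A t‖ ≤ K) (hB : ∀ t, |t| ≤ T → ‖picardTerm A b x₀ 0 t‖ ≤ B)
    (n : ℕ) {t : ℝ} (ht : |t| ≤ T) :
    ‖picardTerm A b x₀ n t‖ ≤ B * (K ^ n * |t| ^ n / n.factorial) := by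
  induction n generalizing t with
  | zero => simpa using hB t ht
  | succ n ih =>
    have hK0 : 0 ≤ K := (norm_nonneg _).trans (hK t ht)
    have hle : ∀ τ ∈ Set.uIoc 0 t, ‖A τ (picardTerm A b x₀ n τ)‖
        ≤ (K * (B * K ^ n / n.factorial)) * |τ - 0| ^ n := fun τ hτ => by
      have hτT : |τ| ≤ T := (abs_le_of_mem_uIoc_zero hτ).trans ht
      calc ‖A τ (picardTerm A b x₀ n τ)‖ ≤ ‖A τ‖ * ‖picardTerm A b x₀ n τ‖ := (A τ).le_opNorm _
        _ ≤ K * (B * (K ^ n * |τ| ^ n / n.factorial)) := by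
            gcongr
            exacts [hK τ hτT, ih hτT]
        _ = (K * (B * K ^ n / n.factorial)) * |τ - 0| ^ n := by rw [sub_zero]; ring
    calc ‖picardTerm A b x₀ (n + 1) t‖
        ≤ ∫ τ in Set.uIoc 0 t, ‖A τ (picardTerm A b x₀ n τ)‖ :=
          intervalIntegral.norm_integral_le_integral_norm_uIoc
      _ ≤ ∫ τ in Set.uIoc 0 t, (K * (B * K ^ n / n.factorial)) * |τ - 0| ^ n :=
          setIntegral_mono_on
            ((hA.clm_apply (continuous_picardTerm hA hb x₀ n)).norm.intervalIntegrable 0 t).def'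
            (Continuous.intervalIntegrable (by fun_prop) 0 t).def' measurableSet_uIoc hle
      _ = B * (K ^ (n + 1) * |t| ^ (n + 1) / (n + 1).factorial) := by
          rw [integral_const_mul, integral_pow_abs_sub_uIoc, Nat.factorial_succ, sub_zero]
          push_cast
          field_simp
          ring

theorem exists_summable_norm_picardTerm_le (hA : Continuous A) (hb : Continuous b) (x₀ : E)
    (T : ℝ) : ∃ u : ℕ → ℝ, Summable u ∧ ∀ n t, |t| ≤ T → ‖picardTerm A b x₀ n t‖ ≤ u n := by
  obtain ⟨K, hK⟩ := isCompact_Icc.exists_bound_of_continuousOn (s := Set.Icc (-T) T)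
    hA.continuousOn
  obtain ⟨B, hB⟩ := isCompact_Icc.exists_bound_of_continuousOn (s := Set.Icc (-T) T)
    (continuous_picardTerm hA hb x₀ 0).continuousOn
  refine ⟨fun n => B * ((K * T) ^ n / n.factorial),
    (Real.summable_pow_div_factorial _).mul_left _, fun n t ht => ?_⟩
  have hK0 : 0 ≤ K := (norm_nonneg _).trans (hK t (abs_le.mp ht))
  have hB0 : 0 ≤ B := (norm_nonneg _).trans (hB t (abs_le.mp ht))
  refine (norm_picardTerm_le hA hb (fun t ht => hK t (abs_le.mp ht))
    (fun t ht => hB t (abs_le.mp ht)) n ht).trans ?_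
  simp only [mul_pow]
  gcongr

theorem contDiff_of_hasDerivAt_linear (hA : ContDiff ℝ ∞ A) (hb : ContDiff ℝ ∞ b) {Φ : ℝ → E}
    (hΦ : ∀ t, HasDerivAt Φ (A t (Φ t) + b t) t) : ContDiff ℝ ∞ Φ := by
  refine contDiff_infty.mpr fun n => ?_
  induction n with
  | zero =>
    exact contDiff_zero.mpr (continuous_iff_continuousAt.mpr fun t => (hΦ t).continuousAt)
  | succ n ih =>
    push_cast
    refine contDiff_succ_iff_deriv.mpr ⟨fun t => (hΦ t).differentiableAt, by simp, ?_⟩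
    rw [funext fun t => (hΦ t).deriv]
    exact ((hA.of_le (mod_cast le_top)).clm_apply ih).add (hb.of_le (mod_cast le_top))

variable [CompleteSpace E]

theorem summable_picardTerm (hA : Continuous A) (hb : Continuous b) (x₀ : E) (t : ℝ) :
    Summable fun n => picardTerm A b x₀ n t :=
  let ⟨_, hu, h⟩ := exists_summable_norm_picardTerm_le hA hb x₀ |t|
  .of_norm_bounded hu fun n => h n t le_rfl

theorem continuous_tsum_picardTerm (hA : Continuous A) (hb : Continuous b) (x₀ : E) :
    Continuous fun t => ∑' n, picardTerm A b x₀ n t := by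
  refine continuous_iff_continuousAt.mpr fun t => ?_
  obtain ⟨u, hu, h⟩ := exists_summable_norm_picardTerm_le hA hb x₀ (|t| + 1)
  have hnhds : {τ : ℝ | |τ| ≤ |t| + 1} ∈ nhds t :=
    Filter.mem_of_superset ((isOpen_lt continuous_abs continuous_const).mem_nhds
      (by simp : |t| < |t| + 1)) fun τ (hτ : |τ| < |t| + 1) => hτ.le
  exact (continuousOn_tsum (fun n => (continuous_picardTerm hA hb x₀ n).continuousOn) hu
    fun n τ hτ => h n τ hτ).continuousAt hnhds

theorem tsum_picardTerm_eq (hA : Continuous A) (hb : Continuous b) (x₀ : E) (t : ℝ) :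
    ∑' n, picardTerm A b x₀ n t = (x₀ + ∫ τ in (0 : ℝ)..t, b τ)
      + ∫ τ in (0 : ℝ)..t, A τ (∑' n, picardTerm A b x₀ n τ) := by
  obtain ⟨u, hu, h⟩ := exists_summable_norm_picardTerm_le hA hb x₀ |t|
  obtain ⟨K, hK⟩ := isCompact_Icc.exists_bound_of_continuousOn (s := Set.Icc (-|t|) |t|)
    hA.continuousOn
  have hle : ∀ n, ∀ τ ∈ Set.uIoc 0 t, ‖A τ (picardTerm A b x₀ n τ)‖ ≤ K * u n := fun n τ hτ => by
    have hAτ := hK τ (abs_le.mp (abs_le_of_mem_uIoc_zero hτ))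
    exact (A τ).le_of_opNorm_le_of_le hAτ (h n τ (abs_le_of_mem_uIoc_zero hτ))
  have hsum : HasSum (fun n => ∫ τ in (0 : ℝ)..t, A τ (picardTerm A b x₀ n τ))
      (∫ τ in (0 : ℝ)..t, A τ (∑' n, picardTerm A b x₀ n τ)) :=
    intervalIntegral.hasSum_integral_of_dominated_convergence (fun n _ => K * u n)
      (fun n => (hA.clm_apply (continuous_picardTerm hA hb x₀ n)).aestronglyMeasurable)
      (fun n => .of_forall (hle n)) (.of_forall fun τ _ => hu.mul_left K) intervalIntegrable_const
      (.of_forall fun τ _ => (A τ).hasSum (summable_picardTerm hA hb x₀ τ).hasSum)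
  rw [(summable_picardTerm hA hb x₀ t).tsum_eq_zero_add, ← hsum.tsum_eq]
  rfl

theorem exists_hasDerivAt_linear (hA : Continuous A) (hb : Continuous b) (x₀ : E) :
    ∃ Φ : ℝ → E, Φ 0 = x₀ ∧ ∀ t, HasDerivAt Φ (A t (Φ t) + b t) t := by
  set Φ : ℝ → E := fun t => ∑' n, picardTerm A b x₀ n t
  have hΦ : ∀ t, Φ t = (x₀ + ∫ τ in (0 : ℝ)..t, b τ) + ∫ τ in (0 : ℝ)..t, A τ (Φ τ) :=
    tsum_picardTerm_eq hA hb x₀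
  refine ⟨Φ, by simp [hΦ 0], fun t => ?_⟩
  have hprim := ((hb.integral_hasStrictDerivAt 0 t).hasDerivAt.const_add x₀).add
    ((hA.clm_apply (continuous_tsum_picardTerm hA hb x₀)).integral_hasStrictDerivAt 0 t).hasDerivAt
  rw [add_comm]
  exact hprim.congr_of_eventuallyEq (.of_forall hΦ)

end LinearODE

/-! ### Two-point boundary value problems -/

section BoundaryValueProblem

theorem surjective_of_ker_le_ker {K V D : Type*} [DivisionRing K] [AddCommGroup V] [Module K V]
    [AddCommGroup D] [Module K D] [FiniteDimensional K D] {f g : V →ₗ[K] D}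
    (hf : Function.Surjective f) (h : LinearMap.ker g ≤ LinearMap.ker f) :
    Function.Surjective g := by
  obtain ⟨r, hr⟩ := f.exists_rightInverse_of_surjective (LinearMap.range_eq_top.mpr hf)
  have hinj : Function.Injective (g ∘ₗ r) := by
    refine (injective_iff_map_eq_zero _).mpr fun d hd => ?_
    rw [← LinearMap.id_apply (R := K) d, ← hr]
    exact h hd
  exact Function.Surjective.of_comp (LinearMap.injective_iff_surjective.mp hinj)

section FredholmAlternative

variable {D : Type*} [NormedAddCommGroup D] [NormedSpace ℝ D]

/-- The solutions of `Φ' = A Φ` whose first component vanishes at `0`: the shooting space of the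
boundary value problem in which the first component is prescribed at both ends. -/
def shootingSpace (A : ℝ → D × D →L[ℝ] D × D) : Submodule ℝ (ℝ → D × D) where
  carrier := {Φ | (∀ t, HasDerivAt Φ (A t (Φ t)) t) ∧ (Φ 0).1 = 0}
  zero_mem' := ⟨fun t => (hasDerivAt_const t 0).congr_deriv (map_zero (A t)).symm, rfl⟩
  add_mem' {Φ Ψ} hΦ hΨ :=
    ⟨fun t => ((hΦ.1 t).add (hΨ.1 t)).congr_deriv (map_add (A t) _ _).symm, by
      simp [hΦ.2, hΨ.2]⟩
  smul_mem' c Φ hΦ :=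
    ⟨fun t => ((hΦ.1 t).const_smul c).congr_deriv (map_smul (A t) c _).symm, by simp [hΦ.2]⟩

theorem exists_solution_of_unique [FiniteDimensional ℝ D] {A : ℝ → D × D →L[ℝ] D × D}
    {b : ℝ → D × D} (hA : Continuous A) (hb : Continuous b)
    (huniq : ∀ Φ ∈ shootingSpace A, (Φ 1).1 = 0 → Φ 0 = 0) :
    ∃ Φ : ℝ → D × D, (∀ t, HasDerivAt Φ (A t (Φ t) + b t) t) ∧ (Φ 0).1 = 0 ∧ (Φ 1).1 = 0 := by
  have : CompleteSpace D := FiniteDimensional.complete ℝ D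
  let initial : shootingSpace A →ₗ[ℝ] D :=
    LinearMap.snd ℝ D D ∘ₗ LinearMap.proj 0 ∘ₗ (shootingSpace A).subtype
  let final : shootingSpace A →ₗ[ℝ] D :=
    LinearMap.fst ℝ D D ∘ₗ LinearMap.proj 1 ∘ₗ (shootingSpace A).subtype
  have hinitial : Function.Surjective initial := fun d => by
    obtain ⟨Φ, hΦ0, hΦ⟩ := exists_hasDerivAt_linear hA continuous_zero (0, d)
    exact ⟨⟨Φ, by simpa using hΦ, by simp [hΦ0]⟩, congrArg Prod.snd hΦ0⟩
  have hker : LinearMap.ker final ≤ LinearMap.ker initial := fun Φ hΦ =>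
    congrArg Prod.snd (huniq Φ Φ.2 hΦ)
  obtain ⟨Φ, hΦ0, hΦ⟩ := exists_hasDerivAt_linear hA hb 0
  obtain ⟨Ψ, hΨ⟩ := surjective_of_ker_le_ker hinitial hker (-(Φ 1).1)
  refine ⟨Φ + Ψ, fun t => ((hΦ t).add (Ψ.2.1 t)).congr_deriv ?_, ?_, ?_⟩
  · rw [Pi.add_apply, map_add]
    abel
  · simp [hΦ0, Ψ.2.2]
  · exact add_eq_zero_iff_eq_neg'.mpr hΨ

end FredholmAlternative

theorem eqOn_iteratedDeriv {f g : ℝ → ℂ} {s : Set ℝ} (hs : UniqueDiffOn ℝ s) (hf : ContDiff ℝ ∞ f)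
    (hg : ContDiff ℝ ∞ g) (h : Set.EqOn f g s) (n : ℕ) :
    Set.EqOn (iteratedDeriv n f) (iteratedDeriv n g) s := fun y hy => by
  rw [← iteratedDerivWithin_eq_iteratedDeriv hs (contDiff_infty.mp hf n).contDiffAt hy,
    ← iteratedDerivWithin_eq_iteratedDeriv hs (contDiff_infty.mp hg n).contDiffAt hy]
  exact iteratedDerivWithin_congr h hy

/-- `ψ` solves `ψ'''' = α ψ'' + β ψ + f` on the line, with clamped ends `0` and `1`. -/
structure IsClampedSolution (α β f ψ : ℝ → ℂ) : Prop where
  smooth : ContDiff ℝ ∞ ψ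
  ode : ∀ y, iteratedDeriv 4 ψ y = α y * iteratedDeriv 2 ψ y + β y * ψ y + f y
  zero_zero : ψ 0 = 0
  zero_one : ψ 1 = 0
  deriv_zero : deriv ψ 0 = 0
  deriv_one : deriv ψ 1 = 0

/-- The matrix of the first order system for `((ψ, ψ'), (ψ'', ψ'''))` that is equivalent to
`ψ'''' = a ψ'' + b ψ`. -/
def companion (a b : ℂ) : (ℂ × ℂ) × (ℂ × ℂ) →L[ℝ] (ℂ × ℂ) × (ℂ × ℂ) :=
  LinearMap.toContinuousLinearMap
    { toFun := fun q => ((q.1.2, q.2.1), (q.2.2, a * q.2.1 + b * q.1.1))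
      map_add' := fun p q => by ext <;> (simp; try ring)
      map_smul' := fun c q => by ext <;> (simp; try ring) }

theorem companion_apply (a b : ℂ) (q : (ℂ × ℂ) × (ℂ × ℂ)) :
    companion a b q = ((q.1.2, q.2.1), (q.2.2, a * q.2.1 + b * q.1.1)) := rfl

variable {α β f : ℝ → ℂ}

theorem contDiff_companion (hα : ContDiff ℝ ∞ α) (hβ : ContDiff ℝ ∞ β) :
    ContDiff ℝ ∞ fun y => companion (α y) (β y) :=
  contDiff_clm_apply_iff.mpr fun q => by simp only [companion_apply]; fun_prop

section Companion

variable {Φ : ℝ → (ℂ × ℂ) × (ℂ × ℂ)}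
  (hΦ : ∀ y, HasDerivAt Φ (companion (α y) (β y) (Φ y) + ((0, 0), (0, f y))) y)
include hΦ

theorem deriv_of_companion : deriv (fun y => (Φ y).1.1) = fun y => (Φ y).1.2 :=
  funext fun y => by simpa [companion_apply] using (hΦ y).hasFDerivAt.fst.fst.hasDerivAt.deriv

theorem iteratedDeriv_two_of_companion :
    iteratedDeriv 2 (fun y => (Φ y).1.1) = fun y => (Φ y).2.1 := by
  rw [iteratedDeriv_succ', deriv_of_companion hΦ, iteratedDeriv_one]
  exact funext fun y => by simpa [companion_apply] using (hΦ y).hasFDerivAt.fst.snd.hasDerivAt.deriv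

theorem iteratedDeriv_three_of_companion :
    iteratedDeriv 3 (fun y => (Φ y).1.1) = fun y => (Φ y).2.2 := by
  rw [iteratedDeriv_succ, iteratedDeriv_two_of_companion hΦ]
  exact funext fun y => by simpa [companion_apply] using (hΦ y).hasFDerivAt.snd.fst.hasDerivAt.deriv

theorem iteratedDeriv_four_of_companion (y : ℝ) :
    iteratedDeriv 4 (fun y => (Φ y).1.1) y = α y * (Φ y).2.1 + β y * (Φ y).1.1 + f y := by
  rw [iteratedDeriv_succ, iteratedDeriv_three_of_companion hΦ]
  simpa [companion_apply] using (hΦ y).hasFDerivAt.snd.snd.hasDerivAt.deriv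

theorem isClampedSolution_of_companion (hα : ContDiff ℝ ∞ α) (hβ : ContDiff ℝ ∞ β)
    (hf : ContDiff ℝ ∞ f) (h0 : (Φ 0).1 = 0) (h1 : (Φ 1).1 = 0) :
    IsClampedSolution α β f fun y => (Φ y).1.1 where
  smooth := (contDiff_of_hasDerivAt_linear (contDiff_companion hα hβ) (by fun_prop) hΦ).fst.fst
  ode y := by rw [iteratedDeriv_four_of_companion hΦ, iteratedDeriv_two_of_companion hΦ]
  zero_zero := congrArg Prod.fst h0
  zero_one := congrArg Prod.fst h1
  deriv_zero := (congrFun (deriv_of_companion hΦ) 0).trans (congrArg Prod.snd h0)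
  deriv_one := (congrFun (deriv_of_companion hΦ) 1).trans (congrArg Prod.snd h1)

theorem eq_zero_of_companion (hψ : ContDiff ℝ ∞ fun y => (Φ y).1.1)
    (h : Set.EqOn (fun y => (Φ y).1.1) 0 (Set.Icc 0 1)) : Φ 0 = 0 := by
  have hzero : ∀ n, iteratedDeriv n (fun y => (Φ y).1.1) 0 = 0 := fun n => by
    simpa using eqOn_iteratedDeriv (uniqueDiffOn_Icc zero_lt_one) hψ (contDiff_const (c := 0)) h n
      (Set.left_mem_Icc.mpr zero_le_one)
  refine Prod.ext (Prod.ext ?_ ?_) (Prod.ext ?_ ?_)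
  · simpa using hzero 0
  · exact (congrFun (deriv_of_companion hΦ) 0).symm.trans (by simpa using hzero 1)
  · exact (congrFun (iteratedDeriv_two_of_companion hΦ) 0).symm.trans (hzero 2)
  · exact (congrFun (iteratedDeriv_three_of_companion hΦ) 0).symm.trans (hzero 3)

end Companion

theorem exists_isClampedSolution (hα : ContDiff ℝ ∞ α) (hβ : ContDiff ℝ ∞ β) (hf : ContDiff ℝ ∞ f)
    (huniq : ∀ ψ, IsClampedSolution α β 0 ψ → Set.EqOn ψ 0 (Set.Icc 0 1)) :
    ∃ ψ, IsClampedSolution α β f ψ := by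
  have hhom : ∀ Φ ∈ shootingSpace fun y => companion (α y) (β y), (Φ 1).1 = 0 → Φ 0 = 0 := by
    rintro Φ ⟨hΦ, h0⟩ h1
    have hΦ' : ∀ y, HasDerivAt Φ
        (companion (α y) (β y) (Φ y) + ((0, 0), (0, (0 : ℝ → ℂ) y))) y := fun y =>
      (hΦ y).congr_deriv (add_zero _).symm
    have hψ := isClampedSolution_of_companion hΦ' hα hβ contDiff_const h0 h1
    exact eq_zero_of_companion hΦ' hψ.smooth (huniq _ hψ)
  obtain ⟨Φ, hΦ, h0, h1⟩ := exists_solution_of_unique (b := fun y => ((0, 0), (0, f y)))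
    (contDiff_companion hα hβ).continuous (by have := hf.continuous; fun_prop) hhom
  exact ⟨_, isClampedSolution_of_companion hΦ hα hβ hf h0 h1⟩

end BoundaryValueProblem

/-! ### Partial derivatives of smooth functions on the plane -/

section PartialDerivatives

variable {f g : ℝ × ℝ → ℂ}

@[fun_prop]
theorem contDiff_dx (hf : ContDiff ℝ ∞ f) : ContDiff ℝ ∞ (dx f) :=
  (hf.fderiv_right (by simp)).clm_apply contDiff_const

@[fun_prop]
theorem contDiff_dy (hf : ContDiff ℝ ∞ f) : ContDiff ℝ ∞ (dy f) :=
  (hf.fderiv_right (by simp)).clm_apply contDiff_const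

@[fun_prop]
theorem contDiff_lap (hf : ContDiff ℝ ∞ f) : ContDiff ℝ ∞ (lap f) :=
  (contDiff_dx (contDiff_dx hf)).add (contDiff_dy (contDiff_dy hf))

@[fun_prop]
theorem contDiff_ofReal : ContDiff ℝ ∞ Complex.ofReal :=
  Complex.ofRealCLM.contDiff

theorem hasDerivAt_fst (hf : ContDiff ℝ ∞ f) (x y : ℝ) :
    HasDerivAt (fun x => f (x, y)) (dx f (x, y)) x :=
  (hf.differentiable (by simp) (x, y)).hasFDerivAt.comp_hasDerivAt x
    ((hasDerivAt_id x).prodMk (hasDerivAt_const x y))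

theorem hasDerivAt_snd (hf : ContDiff ℝ ∞ f) (x y : ℝ) :
    HasDerivAt (fun y => f (x, y)) (dy f (x, y)) y :=
  (hf.differentiable (by simp) (x, y)).hasFDerivAt.comp_hasDerivAt y
    ((hasDerivAt_const y x).prodMk (hasDerivAt_id y))

theorem fderiv_apply_const {θ : ℝ × ℝ → ℝ × ℝ →L[ℝ] ℂ} {z : ℝ × ℝ} (hθ : DifferentiableAt ℝ θ z)
    (a b : ℝ × ℝ) : fderiv ℝ (fun z => θ z a) z b = fderiv ℝ θ z b a := by
  rw [fderiv_clm_apply hθ (differentiableAt_const _)]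
  simp

theorem dx_dy_comm (hf : ContDiff ℝ ∞ f) : dx (dy f) = dy (dx f) := by
  funext z
  have hf' : DifferentiableAt ℝ (fderiv ℝ f) z :=
    (hf.fderiv_right (m := ∞) (by simp)).differentiable (by simp) z
  calc dx (dy f) z = fderiv ℝ (fderiv ℝ f) z (1, 0) (0, 1) := fderiv_apply_const hf' _ _
    _ = fderiv ℝ (fderiv ℝ f) z (0, 1) (1, 0) := hf.contDiffAt.isSymmSndFDerivAt
        (by simpa using WithTop.coe_le_coe.mpr (le_top (a := (2 : ℕ∞)))) _ _
    _ = dy (dx f) z := (fderiv_apply_const hf' _ _).symm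

theorem dx_add (hf : ContDiff ℝ ∞ f) (hg : ContDiff ℝ ∞ g) :
    dx (fun z => f z + g z) = fun z => dx f z + dx g z :=
  funext fun z => ((hasDerivAt_fst (hf.add hg) z.1 z.2).unique
    ((hasDerivAt_fst hf z.1 z.2).add (hasDerivAt_fst hg z.1 z.2)))

theorem dy_add (hf : ContDiff ℝ ∞ f) (hg : ContDiff ℝ ∞ g) :
    dy (fun z => f z + g z) = fun z => dy f z + dy g z :=
  funext fun z => ((hasDerivAt_snd (hf.add hg) z.1 z.2).unique
    ((hasDerivAt_snd hf z.1 z.2).add (hasDerivAt_snd hg z.1 z.2)))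

theorem dx_sub (hf : ContDiff ℝ ∞ f) (hg : ContDiff ℝ ∞ g) :
    dx (fun z => f z - g z) = fun z => dx f z - dx g z :=
  funext fun z => ((hasDerivAt_fst (hf.sub hg) z.1 z.2).unique
    ((hasDerivAt_fst hf z.1 z.2).sub (hasDerivAt_fst hg z.1 z.2)))

theorem dy_sub (hf : ContDiff ℝ ∞ f) (hg : ContDiff ℝ ∞ g) :
    dy (fun z => f z - g z) = fun z => dy f z - dy g z :=
  funext fun z => ((hasDerivAt_snd (hf.sub hg) z.1 z.2).unique
    ((hasDerivAt_snd hf z.1 z.2).sub (hasDerivAt_snd hg z.1 z.2)))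

theorem dx_const_mul (c : ℂ) (hf : ContDiff ℝ ∞ f) :
    dx (fun z => c * f z) = fun z => c * dx f z :=
  funext fun z => (hasDerivAt_fst (contDiff_const.mul hf) z.1 z.2).unique
    ((hasDerivAt_fst hf z.1 z.2).const_mul c)

theorem dy_const_mul (c : ℂ) (hf : ContDiff ℝ ∞ f) :
    dy (fun z => c * f z) = fun z => c * dy f z :=
  funext fun z => (hasDerivAt_snd (contDiff_const.mul hf) z.1 z.2).unique
    ((hasDerivAt_snd hf z.1 z.2).const_mul c)

theorem dx_snd_mul (hf : ContDiff ℝ ∞ f) :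
    dx (fun z => (z.2 : ℂ) * f z) = fun z => (z.2 : ℂ) * dx f z :=
  funext fun z => (hasDerivAt_fst (f := fun z => (z.2 : ℂ) * f z) (by fun_prop) z.1 z.2).unique
    ((hasDerivAt_fst hf z.1 z.2).const_mul (z.2 : ℂ))

theorem dy_snd_mul (hf : ContDiff ℝ ∞ f) :
    dy (fun z => (z.2 : ℂ) * f z) = fun z => f z + (z.2 : ℂ) * dy f z :=
  funext fun z => (hasDerivAt_snd (f := fun z => (z.2 : ℂ) * f z) (by fun_prop) z.1 z.2).unique
    (((Complex.ofRealCLM.hasDerivAt (x := z.2)).mul (hasDerivAt_snd hf z.1 z.2)).congr_deriv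
      (by simp))

theorem dx_neg (f : ℝ × ℝ → ℂ) : dx (fun z => -f z) = fun z => -dx f z :=
  funext fun z => by simp [dx, fderiv_fun_neg]

theorem dy_neg (f : ℝ × ℝ → ℂ) : dy (fun z => -f z) = fun z => -dy f z :=
  funext fun z => by simp [dy, fderiv_fun_neg]

theorem fderiv_periodic {ℓ : ℝ} {c : ℂ} (h : ∀ x y, f (x + ℓ, y) = f (x, y) + c) (x y : ℝ) :
    fderiv ℝ f (x + ℓ, y) = fderiv ℝ f (x, y) := by
  have hshift : (fun z : ℝ × ℝ => f (z + (ℓ, 0))) = fun z => f z + c :=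
    funext fun z => by simpa [Prod.ext_iff] using (congrArg f (by ext <;> simp)).trans (h z.1 z.2)
  have := fderiv_comp_add_right (𝕜 := ℝ) (f := f) (x := (x, y)) (ℓ, 0)
  rw [hshift, fderiv_add_const] at this
  simpa using this.symm

theorem dx_periodic {ℓ : ℝ} {c : ℂ} (h : ∀ x y, f (x + ℓ, y) = f (x, y) + c) (x y : ℝ) :
    dx f (x + ℓ, y) = dx f (x, y) := by rw [dx, dx, fderiv_periodic h]

theorem dy_periodic {ℓ : ℝ} {c : ℂ} (h : ∀ x y, f (x + ℓ, y) = f (x, y) + c) (x y : ℝ) :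
    dy f (x + ℓ, y) = dy f (x, y) := by rw [dy, dy, fderiv_periodic h]

theorem lap_periodic {ℓ : ℝ} {c : ℂ} (h : ∀ x y, f (x + ℓ, y) = f (x, y) + c) (x y : ℝ) :
    lap f (x + ℓ, y) = lap f (x, y) := by
  rw [lap, lap, dx_periodic (c := 0) (by simpa using dx_periodic h),
    dy_periodic (c := 0) (by simpa using dy_periodic h)]

theorem fderiv_apply_eq (f : ℝ × ℝ → ℂ) (z a : ℝ × ℝ) :
    fderiv ℝ f z a = a.1 • dx f z + a.2 • dy f z := by
  rw [dx, dy, ← map_smul, ← map_smul, ← map_add]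
  simp

theorem exists_hasFDerivAt_of_dy_eq_dx {a b : ℝ × ℝ → ℂ} (ha : ContDiff ℝ ∞ a)
    (hb : ContDiff ℝ ∞ b) (hcurl : dy a = dx b) :
    ∃ p : ℝ × ℝ → ℂ, ∀ z, HasFDerivAt p ((ContinuousLinearMap.fst ℝ ℝ ℝ).smulRight (a z)
      + (ContinuousLinearMap.snd ℝ ℝ ℝ).smulRight (b z)) z := by
  set θ : ℝ × ℝ → ℝ × ℝ →L[ℝ] ℂ := fun z => (ContinuousLinearMap.fst ℝ ℝ ℝ).smulRight (a z)
    + (ContinuousLinearMap.snd ℝ ℝ ℝ).smulRight (b z)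
  have hθ : ContDiff ℝ ∞ θ := contDiff_clm_apply_iff.mpr fun c => by
    simp only [θ, add_apply, ContinuousLinearMap.smulRight_apply]
    fun_prop
  have hdθ : ∀ z c d, fderiv ℝ θ z c d
      = d.1 • (c.1 • dx a z + c.2 • dy a z) + d.2 • (c.1 • dx b z + c.2 • dy b z) := by
    intro z c d
    have hθ' : HasFDerivAt (fun z => θ z d) (d.1 • fderiv ℝ a z + d.2 • fderiv ℝ b z) z :=
      ((ha.differentiable (by simp) z).hasFDerivAt.const_smul d.1).add
        ((hb.differentiable (by simp) z).hasFDerivAt.const_smul d.2)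
    rw [← fderiv_apply_eq, ← fderiv_apply_eq,
      ← fderiv_apply_const (hθ.differentiable (by simp) z), hθ'.fderiv]
    rfl
  obtain ⟨p, hp⟩ := convex_univ.exists_forall_hasFDerivAt_of_fderiv_symmetric isOpen_univ
    (hθ.differentiable (by simp)).differentiableOn fun z _ c d => by
      rw [hdθ, hdθ, hcurl]
      module
  exact ⟨p, fun z => hp z trivial⟩

theorem exists_potential {ℓ : ℝ} {a b : ℝ × ℝ → ℂ} (ha : ContDiff ℝ ∞ a) (hb : ContDiff ℝ ∞ b)
    (hpa : ∀ x y, a (x + ℓ, y) = a (x, y)) (hpb : ∀ x y, b (x + ℓ, y) = b (x, y))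
    (hcurl : dy a = dx b) : ∃ p : ℝ × ℝ → ℂ, ContDiff ℝ ∞ p ∧
      (∃ c : ℂ, ∀ x y, p (x + ℓ, y) = p (x, y) + c) ∧ dx p = a ∧ dy p = b := by
  obtain ⟨p, hp⟩ := exists_hasFDerivAt_of_dy_eq_dx ha hb hcurl
  have hsmooth : ContDiff ℝ ∞ p := by
    refine contDiff_infty_iff_fderiv.mpr ⟨fun z => (hp z).differentiableAt, ?_⟩
    refine contDiff_clm_apply_iff.mpr fun c => ?_
    simp only [(hp _).fderiv, add_apply, ContinuousLinearMap.smulRight_apply]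
    fun_prop
  have hshift : ∀ z : ℝ × ℝ, HasFDerivAt (fun z => p (z + (ℓ, 0)) - p z) 0 z := fun z => by
    have hz : z + (ℓ, 0) = (z.1 + ℓ, z.2) := by ext <;> simp
    refine (((hasFDerivAt_comp_add_right (ℓ, 0)).mpr (hp _)).sub (hp z)).congr_fderiv ?_
    rw [hz, hpa, hpb, sub_self]
  refine ⟨p, hsmooth, ⟨p (ℓ, 0) - p 0, fun x y => ?_⟩, funext fun z => ?_, funext fun z => ?_⟩
  · have := is_const_of_fderiv_eq_zero (𝕜 := ℝ) (fun z => (hshift z).differentiableAt)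
      (fun z => (hshift z).fderiv) (x, y) 0
    simp only [Prod.mk_add_mk, zero_add, add_zero] at this
    rw [← this, add_sub_cancel]
  · simp [dx, (hp z).fderiv]
  · simp [dy, (hp z).fderiv]

end PartialDerivatives

/-! ### The linearized equations, their divergence and their vorticity -/

section LinearizedEquations

variable {ℓ R : ℝ} {f g u v p u' v' p' : ℝ × ℝ → ℂ}

/-- The divergence of the field `(u, v)` on the plane. -/
def divergence (u v : ℝ × ℝ → ℂ) (z : ℝ × ℝ) : ℂ := dx u z + dy v z

/-- The vorticity (scalar curl) of the field `(u, v)` on the plane. -/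
def vorticity (u v : ℝ × ℝ → ℂ) (z : ℝ × ℝ) : ℂ := dx v z - dy u z

@[fun_prop]
theorem contDiff_divergence (hu : ContDiff ℝ ∞ u) (hv : ContDiff ℝ ∞ v) :
    ContDiff ℝ ∞ (divergence u v) :=
  (contDiff_dx hu).add (contDiff_dy hv)

@[fun_prop]
theorem contDiff_vorticity (hu : ContDiff ℝ ∞ u) (hv : ContDiff ℝ ∞ v) :
    ContDiff ℝ ∞ (vorticity u v) :=
  (contDiff_dx hv).sub (contDiff_dy hu)

@[fun_prop]
theorem contDiff_advU (hu : ContDiff ℝ ∞ u) (hv : ContDiff ℝ ∞ v) : ContDiff ℝ ∞ (advU u v) := by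
  unfold advU
  fun_prop

@[fun_prop]
theorem contDiff_advV (hv : ContDiff ℝ ∞ v) : ContDiff ℝ ∞ (advV v) := by
  unfold advV
  fun_prop

@[fun_prop]
theorem contDiff_rhsU (hu : ContDiff ℝ ∞ u) (hv : ContDiff ℝ ∞ v) (hp : ContDiff ℝ ∞ p) :
    ContDiff ℝ ∞ (rhsU R u v p) := by
  unfold rhsU
  fun_prop

@[fun_prop]
theorem contDiff_rhsV (hv : ContDiff ℝ ∞ v) (hp : ContDiff ℝ ∞ p) :
    ContDiff ℝ ∞ (rhsV R v p) := by
  unfold rhsV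
  fun_prop

theorem lap_add (hf : ContDiff ℝ ∞ f) (hg : ContDiff ℝ ∞ g) :
    lap (fun z => f z + g z) = fun z => lap f z + lap g z := by
  unfold lap
  simp (disch := fun_prop) only [dx_add, dy_add]
  exact funext fun z => by ring

theorem lap_sub (hf : ContDiff ℝ ∞ f) (hg : ContDiff ℝ ∞ g) :
    lap (fun z => f z - g z) = fun z => lap f z - lap g z := by
  unfold lap
  simp (disch := fun_prop) only [dx_sub, dy_sub]
  exact funext fun z => by ring

theorem lap_const_mul (c : ℂ) (hf : ContDiff ℝ ∞ f) :
    lap (fun z => c * f z) = fun z => c * lap f z := by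
  unfold lap
  simp (disch := fun_prop) only [dx_const_mul, dy_const_mul]
  exact funext fun z => by ring

theorem dx_lap (hf : ContDiff ℝ ∞ f) : dx (lap f) = lap (dx f) := by
  unfold lap
  simp (disch := fun_prop) only [dx_add, dx_dy_comm]

theorem dy_lap (hf : ContDiff ℝ ∞ f) : dy (lap f) = lap (dy f) := by
  unfold lap
  simp (disch := fun_prop) only [dy_add, dx_dy_comm]

theorem divergence_rhs (hu : ContDiff ℝ ∞ u) (hv : ContDiff ℝ ∞ v) (hp : ContDiff ℝ ∞ p)
    (z : ℝ × ℝ) : divergence (rhsU R u v p) (rhsV R v p) z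
      = (1 / R : ℂ) * lap (divergence u v) z - (dx (advU u v) z + dy (advV v) z) - lap p z := by
  unfold divergence rhsU rhsV
  simp (disch := fun_prop) only [dx_sub, dy_sub, dx_const_mul, dy_const_mul, dx_lap, dy_lap,
    lap_add]
  rw [show lap p z = dx (dx p) z + dy (dy p) z from rfl]
  ring

theorem vorticity_rhs (hu : ContDiff ℝ ∞ u) (hv : ContDiff ℝ ∞ v) (hp : ContDiff ℝ ∞ p)
    (z : ℝ × ℝ) : vorticity (rhsU R u v p) (rhsV R v p) z
      = (1 / R : ℂ) * lap (vorticity u v) z - z.2 * dx (vorticity u v) z + divergence u v z := by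
  unfold vorticity rhsU rhsV advU advV divergence
  simp (disch := fun_prop) only [dx_sub, dy_sub, dy_add, dx_const_mul, dy_const_mul, dx_snd_mul,
    dy_snd_mul, dx_lap, dy_lap, lap_sub, dx_dy_comm]
  ring

theorem rhsU_add_const_mul (hu : ContDiff ℝ ∞ u) (hp : ContDiff ℝ ∞ p) (hu' : ContDiff ℝ ∞ u')
    (hp' : ContDiff ℝ ∞ p') (c : ℂ) :
    rhsU R (fun z => u z + c * u' z) (fun z => v z + c * v' z) (fun z => p z + c * p' z)
      = fun z => rhsU R u v p z + c * rhsU R u' v' p' z := by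
  unfold rhsU advU
  simp (disch := fun_prop) only [lap_add, lap_const_mul, dx_add, dx_const_mul]
  exact funext fun z => by ring

theorem rhsV_add_const_mul (hv : ContDiff ℝ ∞ v) (hp : ContDiff ℝ ∞ p) (hv' : ContDiff ℝ ∞ v')
    (hp' : ContDiff ℝ ∞ p') (c : ℂ) :
    rhsV R (fun z => v z + c * v' z) (fun z => p z + c * p' z)
      = fun z => rhsV R v p z + c * rhsV R v' p' z := by
  unfold rhsV advV
  simp (disch := fun_prop) only [lap_add, lap_const_mul, dx_add, dx_const_mul, dy_add,
    dy_const_mul]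
  exact funext fun z => by ring

theorem IsSmoothSolenoidal.zero : IsSmoothSolenoidal ℓ (fun _ => 0) (fun _ => 0) where
  smooth_u := contDiff_const
  smooth_v := contDiff_const
  periodic_u _ _ := rfl
  periodic_v _ _ := rfl
  div_free x y _ := by simp [dx, dy]
  wall_zero _ := rfl
  wall_one _ := rfl
  flux_zero _ := by simp

theorem IsSmoothSolenoidal.add_const_mul (h : IsSmoothSolenoidal ℓ u v)
    (h' : IsSmoothSolenoidal ℓ u' v') (c : ℂ) :
    IsSmoothSolenoidal ℓ (fun z => u z + c * u' z) (fun z => v z + c * v' z) where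
  smooth_u := h.smooth_u.add (contDiff_const.mul h'.smooth_u)
  smooth_v := h.smooth_v.add (contDiff_const.mul h'.smooth_v)
  periodic_u x y := by rw [h.periodic_u, h'.periodic_u]
  periodic_v x y := by rw [h.periodic_v, h'.periodic_v]
  div_free x y hy := by
    have := h.smooth_u
    have := h.smooth_v
    have := h'.smooth_u
    have := h'.smooth_v
    simp (disch := fun_prop) only [dx_add, dx_const_mul, dy_add, dy_const_mul]
    linear_combination h.div_free x y hy + c * h'.div_free x y hy
  wall_zero x := by rw [h.wall_zero, h'.wall_zero, mul_zero, add_zero]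
  wall_one x := by rw [h.wall_one, h'.wall_one, mul_zero, add_zero]
  flux_zero x := by
    have hcont : Continuous fun y => u (x, y) := h.smooth_u.continuous.comp (by fun_prop)
    have hcont' : Continuous fun y => u' (x, y) := h'.smooth_u.continuous.comp (by fun_prop)
    rw [intervalIntegral.integral_add (hcont.intervalIntegrable _ _)
      ((hcont'.const_mul c).intervalIntegrable _ _), intervalIntegral.integral_const_mul,
      h.flux_zero, h'.flux_zero, mul_zero, add_zero]

/-- The strip `y ∈ [0, 1]` on which the equations are imposed. -/
def strip : Set (ℝ × ℝ) := Set.univ ×ˢ Set.Icc 0 1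

theorem fderiv_eq_zero_of_eqOn_strip (h : Set.EqOn f 0 strip) (hf : ContDiff ℝ ∞ f) {z : ℝ × ℝ}
    (hz : z ∈ strip) : fderiv ℝ f z = 0 := by
  have hstrip : UniqueDiffWithinAt ℝ strip z :=
    (uniqueDiffOn_univ.prod (uniqueDiffOn_Icc zero_lt_one)) z hz
  rw [← fderivWithin_eq_fderiv hstrip (hf.differentiable (by simp) z), fderivWithin_congr h (h hz)]
  simp

theorem lap_eq_zero_of_eqOn_strip (h : Set.EqOn f 0 strip) (hf : ContDiff ℝ ∞ f) {z : ℝ × ℝ}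
    (hz : z ∈ strip) : lap f z = 0 := by
  have hdx : Set.EqOn (dx f) 0 strip := fun w hw => by
    simp [dx, fderiv_eq_zero_of_eqOn_strip h hf hw]
  have hdy : Set.EqOn (dy f) 0 strip := fun w hw => by
    simp [dy, fderiv_eq_zero_of_eqOn_strip h hf hw]
  rw [lap, dx, dy, fderiv_eq_zero_of_eqOn_strip hdx (contDiff_dx hf) hz,
    fderiv_eq_zero_of_eqOn_strip hdy (contDiff_dy hf) hz]
  simp

theorem dx_eq_zero_of_forall_eq_zero (hf : ContDiff ℝ ∞ f) {y : ℝ} (h : ∀ x, f (x, y) = 0)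
    (x : ℝ) : dx f (x, y) = 0 := by
  rw [← (hasDerivAt_fst hf x y).deriv, funext h, deriv_const]

theorem rhsV_of_forall_eq_zero (hv : ContDiff ℝ ∞ v) {y : ℝ} (h : ∀ x, v (x, y) = 0) (x : ℝ) :
    rhsV R v p (x, y) = (1 / R : ℂ) * dy (dy v) (x, y) - dy p (x, y) := by
  have hdx := dx_eq_zero_of_forall_eq_zero hv h
  rw [rhsV, lap, advV, hdx, dx_eq_zero_of_forall_eq_zero (contDiff_dx hv) hdx]
  ring

theorem IsSmoothSolenoidal.divergence_rhs (h : IsSmoothSolenoidal ℓ u v) (hp : ContDiff ℝ ∞ p)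
    {x y : ℝ} (hy : y ∈ Set.Icc (0 : ℝ) 1) : divergence (rhsU R u v p) (rhsV R v p) (x, y)
      = -(dx (advU u v) (x, y) + dy (advV v) (x, y)) - lap p (x, y) := by
  have hdiv : Set.EqOn (divergence u v) 0 strip := fun z hz => h.div_free z.1 z.2 hz.2
  rw [Couette.divergence_rhs h.smooth_u h.smooth_v hp, lap_eq_zero_of_eqOn_strip hdiv
    (contDiff_divergence h.smooth_u h.smooth_v) ⟨trivial, hy⟩, mul_zero, zero_sub]

theorem isPressure_iff (h : IsSmoothSolenoidal ℓ u v) (hp : ContDiff ℝ ∞ p)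
    (hper : ∃ c : ℂ, ∀ x y, p (x + ℓ, y) = p (x, y) + c) :
    IsPressure ℓ R u v p ↔ IsSmoothSolenoidal ℓ (rhsU R u v p) (rhsV R v p) := by
  have hu0 : ∀ x y, u (x + ℓ, y) = u (x, y) + 0 := by simpa using h.periodic_u
  have hv0 : ∀ x y, v (x + ℓ, y) = v (x, y) + 0 := by simpa using h.periodic_v
  obtain ⟨c, hc⟩ := hper
  constructor
  · intro hP
    exact
      { smooth_u := contDiff_rhsU h.smooth_u h.smooth_v hp
        smooth_v := contDiff_rhsV h.smooth_v hp
        periodic_u := fun x y => by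
          simp only [rhsU, advU, lap_periodic hu0, dx_periodic hu0, h.periodic_v, dx_periodic hc]
        periodic_v := fun x y => by
          simp only [rhsV, advV, lap_periodic hv0, dx_periodic hv0, dy_periodic hc]
        div_free := fun x y hy => (h.divergence_rhs hp hy).trans <| by
          rw [hP.poisson x y hy, sub_self]
        wall_zero := fun x => by
          rw [rhsV_of_forall_eq_zero h.smooth_v h.wall_zero, hP.wall_zero, sub_self]
        wall_one := fun x => by
          rw [rhsV_of_forall_eq_zero h.smooth_v h.wall_one, hP.wall_one, sub_self]
        flux_zero := hP.flux_zero }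
  · intro hS
    exact
      { smooth := hp
        periodic_grad := ⟨c, hc⟩
        poisson := fun x y hy =>
          (sub_eq_zero.mp ((h.divergence_rhs hp hy).symm.trans (hS.div_free x y hy))).symm
        wall_zero := fun x => (sub_eq_zero.mp
          ((rhsV_of_forall_eq_zero h.smooth_v h.wall_zero x).symm.trans (hS.wall_zero x))).symm
        wall_one := fun x => (sub_eq_zero.mp
          ((rhsV_of_forall_eq_zero h.smooth_v h.wall_one x).symm.trans (hS.wall_one x))).symm
        flux_zero := hS.flux_zero }

theorem IsPressure.add_const_mul (hP : IsPressure ℓ R u v p) (hP' : IsPressure ℓ R u' v' p')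
    (h : IsSmoothSolenoidal ℓ u v) (h' : IsSmoothSolenoidal ℓ u' v') (c : ℂ) :
    IsPressure ℓ R (fun z => u z + c * u' z) (fun z => v z + c * v' z)
      (fun z => p z + c * p' z) := by
  obtain ⟨d, hd⟩ := hP.periodic_grad
  obtain ⟨d', hd'⟩ := hP'.periodic_grad
  refine (isPressure_iff (h.add_const_mul h' c)
    (hP.smooth.add (contDiff_const.mul hP'.smooth)) ⟨d + c * d', fun x y => ?_⟩).mpr ?_
  · rw [hd, hd']
    ring
  · rw [rhsU_add_const_mul h.smooth_u hP.smooth h'.smooth_u hP'.smooth,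
      rhsV_add_const_mul h.smooth_v hP.smooth h'.smooth_v hP'.smooth]
    exact ((isPressure_iff h hP.smooth hP.periodic_grad).mp hP).add_const_mul
      ((isPressure_iff h' hP'.smooth hP'.periodic_grad).mp hP') c

theorem exists_isPressure_of_vorticity_eq (h : IsSmoothSolenoidal ℓ u v)
    (hfg : IsSmoothSolenoidal ℓ f g)
    (hvort : vorticity (rhsU R u v 0) (rhsV R v 0) = vorticity f g) :
    ∃ p, IsPressure ℓ R u v p ∧ rhsU R u v p = f ∧ rhsV R v p = g := by
  have hu := h.smooth_u
  have hv := h.smooth_v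
  have hf := hfg.smooth_u
  have hg := hfg.smooth_v
  have h0 : ContDiff ℝ ∞ (0 : ℝ × ℝ → ℂ) := contDiff_const
  have hu0 : ∀ x y, u (x + ℓ, y) = u (x, y) + 0 := by simpa using h.periodic_u
  have hv0 : ∀ x y, v (x + ℓ, y) = v (x, y) + 0 := by simpa using h.periodic_v
  have h00 : ∀ x y, (0 : ℝ × ℝ → ℂ) (x + ℓ, y) = (0 : ℝ × ℝ → ℂ) (x, y) + 0 := by simp
  obtain ⟨p, hp, hper, hpx, hpy⟩ := exists_potential (ℓ := ℓ)
    (a := fun z => rhsU R u v 0 z - f z) (b := fun z => rhsV R v 0 z - g z)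
    (by fun_prop) (by fun_prop)
    (fun x y => by simp only [rhsU, advU, lap_periodic hu0, dx_periodic hu0, h.periodic_v,
      dx_periodic h00, hfg.periodic_u])
    (fun x y => by simp only [rhsV, advV, lap_periodic hv0, dx_periodic hv0, dy_periodic h00,
      hfg.periodic_v])
    (by
      rw [dy_sub (by fun_prop) hf, dx_sub (by fun_prop) hg]
      funext z
      have hz := congrFun hvort z
      simp only [vorticity] at hz
      linear_combination -hz)
  have hfU : rhsU R u v p = f := funext fun z => by
    rw [rhsU, hpx]
    simp [rhsU, dx]
  have hgV : rhsV R v p = g := funext fun z => by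
    rw [rhsV, hpy]
    simp [rhsV, dy]
  exact ⟨p, (isPressure_iff h hp hper).mpr (by rwa [hfU, hgV]), hfU, hgV⟩

end LinearizedEquations

/-! ### Fourier modes -/

section Fourier

/-- The `k`-th Fourier coefficient in `x` of a function on the strip, as a function of `y`. -/
def modeCoeff (ℓ : ℝ) (k : ℤ) (f : ℝ × ℝ → ℂ) (y : ℝ) : ℂ :=
  (ℓ : ℂ)⁻¹ * ∫ x in (0 : ℝ)..ℓ, fourier (-k) (x : AddCircle ℓ) * f (x, y)

/-- The single Fourier mode `a(y) e^{iκx}`, where `κ` is the `k`-th wavenumber. -/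
def modeField (ℓ : ℝ) (k : ℤ) (a : ℝ → ℂ) (z : ℝ × ℝ) : ℂ :=
  a z.2 * fourier k (z.1 : AddCircle ℓ)

/-- The Laplacian `a'' - κ² a` of the Fourier mode `a(y) e^{iκx}`. -/
def modeLap (κ : ℝ) (a : ℝ → ℂ) (y : ℝ) : ℂ := iteratedDeriv 2 a y - (κ : ℂ) ^ 2 * a y

variable {ℓ : ℝ} {k : ℤ} {f g : ℝ × ℝ → ℂ} {a : ℝ → ℂ}

theorem hasDerivAt_fourier_wavenumber (ℓ : ℝ) (k : ℤ) (x : ℝ) :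
    HasDerivAt (fun x : ℝ => fourier k (x : AddCircle ℓ))
      (Complex.I * wavenumber ℓ k * fourier k (x : AddCircle ℓ)) x := by
  refine (hasDerivAt_fourier ℓ k x).congr_deriv ?_
  simp only [wavenumber]
  push_cast
  ring

theorem wavenumber_neg (ℓ : ℝ) (k : ℤ) : wavenumber ℓ (-k) = -wavenumber ℓ k := by
  simp only [wavenumber]
  push_cast
  ring

@[fun_prop]
theorem contDiff_fourier (ℓ : ℝ) (k : ℤ) :
    ContDiff ℝ ∞ fun x : ℝ => fourier k (x : AddCircle ℓ) := by
  simp only [fourier_coe_apply]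
  fun_prop

@[fun_prop]
theorem continuous_fourier (ℓ : ℝ) (k : ℤ) : Continuous fun x : ℝ => fourier k (x : AddCircle ℓ) :=
  (contDiff_fourier ℓ k).continuous

theorem fourier_period (ℓ : ℝ) (k : ℤ) :
    fourier k ((ℓ : ℝ) : AddCircle ℓ) = fourier k ((0 : ℝ) : AddCircle ℓ) := by
  rw [AddCircle.coe_period, QuotientAddGroup.mk_zero]

theorem intervalIntegrable_fourier_mul (hf : Continuous f) (y : ℝ) :
    IntervalIntegrable (fun x : ℝ => fourier k (x : AddCircle ℓ) * f (x, y)) volume 0 ℓ :=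
  Continuous.intervalIntegrable (by fun_prop) _ _

theorem modeCoeff_add (hf : Continuous f) (hg : Continuous g) :
    modeCoeff ℓ k (fun z => f z + g z) = fun y => modeCoeff ℓ k f y + modeCoeff ℓ k g y := by
  funext y
  simp only [modeCoeff, mul_add]
  rw [intervalIntegral.integral_add (intervalIntegrable_fourier_mul hf y)
    (intervalIntegrable_fourier_mul hg y), mul_add]

theorem modeCoeff_mul_left (c : ℝ → ℂ) (f : ℝ × ℝ → ℂ) :
    modeCoeff ℓ k (fun z => c z.2 * f z) = fun y => c y * modeCoeff ℓ k f y := by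
  funext y
  simp only [modeCoeff, mul_left_comm _ (c y), intervalIntegral.integral_const_mul]

theorem modeCoeff_sub (hf : Continuous f) (hg : Continuous g) :
    modeCoeff ℓ k (fun z => f z - g z) = fun y => modeCoeff ℓ k f y - modeCoeff ℓ k g y := by
  funext y
  simp only [modeCoeff, mul_sub]
  rw [intervalIntegral.integral_sub (intervalIntegrable_fourier_mul hf y)
    (intervalIntegrable_fourier_mul hg y), mul_sub]

theorem modeCoeff_congr {y : ℝ} (h : ∀ x, f (x, y) = g (x, y)) :
    modeCoeff ℓ k f y = modeCoeff ℓ k g y := by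
  simp only [modeCoeff, h]

theorem modeCoeff_eq_zero {y : ℝ} (h : ∀ x, f (x, y) = 0) : modeCoeff ℓ k f y = 0 := by
  simp [modeCoeff, h]

@[fun_prop]
theorem continuous_modeCoeff (hf : Continuous f) : Continuous (modeCoeff ℓ k f) :=
  continuous_const.mul (intervalIntegral.continuous_parametric_intervalIntegral_of_continuous'
    (by unfold Function.uncurry; fun_prop) 0 ℓ)

theorem hasDerivAt_modeCoeff (hf : ContDiff ℝ ∞ f) (y : ℝ) :
    HasDerivAt (modeCoeff ℓ k f) (modeCoeff ℓ k (dy f) y) y := by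
  have hderiv : ∀ t x : ℝ, HasDerivAt (fun t => fourier (-k) (x : AddCircle ℓ) * f (x, t))
      (fourier (-k) (x : AddCircle ℓ) * dy f (x, t)) t :=
    fun t x => (hasDerivAt_snd hf x t).const_mul _
  have hcont := (contDiff_dy hf).continuous
  obtain ⟨B, hB⟩ := ((isCompact_uIcc (a := (0 : ℝ)) (b := ℓ)).prod
    (isCompact_closedBall y 1)).exists_bound_of_continuousOn
    (f := fun z : ℝ × ℝ => fourier (-k) (z.1 : AddCircle ℓ) * dy f z) (by fun_prop)
  refine HasDerivAt.const_mul _ (intervalIntegral.hasDerivAt_integral_of_dominated_loc_of_deriv_le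
    (bound := fun _ => B) (Metric.closedBall_mem_nhds y one_pos)
    (.of_forall fun t => Continuous.aestronglyMeasurable (by fun_prop))
    (intervalIntegrable_fourier_mul hf.continuous y)
    (Continuous.aestronglyMeasurable (by fun_prop))
    (.of_forall fun x hx t ht => hB (x, t) ⟨Set.uIoc_subset_uIcc hx, ht⟩)
    intervalIntegrable_const (.of_forall fun x _ t _ => hderiv t x)).2

theorem deriv_modeCoeff (hf : ContDiff ℝ ∞ f) :
    deriv (modeCoeff ℓ k f) = modeCoeff ℓ k (dy f) :=
  funext fun y => (hasDerivAt_modeCoeff hf y).deriv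

theorem iteratedDeriv_two_modeCoeff (hf : ContDiff ℝ ∞ f) :
    iteratedDeriv 2 (modeCoeff ℓ k f) = modeCoeff ℓ k (dy (dy f)) := by
  rw [iteratedDeriv_succ, iteratedDeriv_one, deriv_modeCoeff hf, deriv_modeCoeff (contDiff_dy hf)]

@[fun_prop]
theorem contDiff_modeCoeff (hf : ContDiff ℝ ∞ f) : ContDiff ℝ ∞ (modeCoeff ℓ k f) := by
  rw [contDiff_infty]
  intro n
  induction n generalizing f with
  | zero => exact contDiff_zero.mpr (continuous_modeCoeff hf.continuous)
  | succ n ih =>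
    push_cast
    rw [contDiff_succ_iff_deriv, deriv_modeCoeff hf]
    exact ⟨fun y => (hasDerivAt_modeCoeff hf y).differentiableAt, by simp, ih (contDiff_dy hf)⟩

theorem modeCoeff_dx (hf : ContDiff ℝ ∞ f) (hper : ∀ x y, f (x + ℓ, y) = f (x, y)) :
    modeCoeff ℓ k (dx f) = fun y => Complex.I * wavenumber ℓ k * modeCoeff ℓ k f y := by
  funext y
  have hboundary : f (ℓ, y) = f (0, y) := by simpa using hper 0 y
  have hparts := intervalIntegral.integral_mul_deriv_eq_deriv_mul (a := 0) (b := ℓ)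
    (fun x _ => hasDerivAt_fourier_wavenumber ℓ (-k) x) (fun x _ => hasDerivAt_fst hf x y)
    (Continuous.intervalIntegrable (by fun_prop) _ _)
    (Continuous.intervalIntegrable ((contDiff_dx hf).continuous.comp (by fun_prop)) _ _)
  rw [fourier_period, hboundary, sub_self, zero_sub] at hparts
  simp only [modeCoeff, hparts, mul_assoc, intervalIntegral.integral_const_mul, wavenumber_neg]
  push_cast
  ring

theorem modeCoeff_lap (hf : ContDiff ℝ ∞ f) (hper : ∀ x y, f (x + ℓ, y) = f (x, y)) :
    modeCoeff ℓ k (lap f) = modeLap (wavenumber ℓ k) (modeCoeff ℓ k f) := by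
  have hper' : ∀ x y, dx f (x + ℓ, y) = dx f (x, y) := dx_periodic (c := 0) (by simpa using hper)
  unfold lap
  rw [modeCoeff_add (contDiff_dx (contDiff_dx hf)).continuous
    (contDiff_dy (contDiff_dy hf)).continuous, modeCoeff_dx (contDiff_dx hf) hper',
    modeCoeff_dx hf hper, ← iteratedDeriv_two_modeCoeff hf]
  funext y
  rw [modeLap]
  linear_combination (wavenumber ℓ k : ℂ) ^ 2 * modeCoeff ℓ k f y * Complex.I_sq

theorem integral_modeCoeff_eq_zero (hf : Continuous f)
    (h : ∀ x, ∫ y in (0 : ℝ)..1, f (x, y) = 0) : ∫ y in (0 : ℝ)..1, modeCoeff ℓ k f y = 0 := by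
  simp only [modeCoeff]
  rw [intervalIntegral.integral_const_mul, intervalIntegral_intervalIntegral_swap]
  · simp [h]
  · have hcont : Continuous (Function.uncurry fun y x : ℝ =>
        fourier (-k) (x : AddCircle ℓ) * f (x, y)) := by
      unfold Function.uncurry
      fun_prop
    exact (hcont.continuousOn.integrableOn_compact (isCompact_uIcc.prod isCompact_uIcc)).mono_set
      (Set.prod_mono Set.uIoc_subset_uIcc Set.uIoc_subset_uIcc)

@[fun_prop]
theorem contDiff_deriv (ha : ContDiff ℝ ∞ a) : ContDiff ℝ ∞ (deriv a) :=
  (contDiff_infty_iff_deriv.mp ha).2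

@[fun_prop]
theorem contDiff_modeField (ha : ContDiff ℝ ∞ a) : ContDiff ℝ ∞ (modeField ℓ k a) :=
  (ha.comp contDiff_snd).mul ((contDiff_fourier ℓ k).comp contDiff_fst)

theorem modeField_periodic (ℓ : ℝ) (k : ℤ) (a : ℝ → ℂ) (x y : ℝ) :
    modeField ℓ k a (x + ℓ, y) = modeField ℓ k a (x, y) := by
  simp only [modeField, AddCircle.coe_add_period]

theorem dx_modeField (ha : ContDiff ℝ ∞ a) :
    dx (modeField ℓ k a) = modeField ℓ k fun y => Complex.I * wavenumber ℓ k * a y :=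
  funext fun z => (hasDerivAt_fst (contDiff_modeField ha) z.1 z.2).unique <|
    ((hasDerivAt_fourier_wavenumber ℓ k z.1).const_mul (a z.2)).congr_deriv <| by
      simp only [modeField]
      ring

theorem dy_modeField (ha : ContDiff ℝ ∞ a) :
    dy (modeField ℓ k a) = modeField ℓ k (deriv a) :=
  funext fun z => (hasDerivAt_snd (contDiff_modeField ha) z.1 z.2).unique <|
    (ha.differentiable (by simp) z.2).hasDerivAt.mul_const
      (fourier k (z.1 : AddCircle ℓ))

theorem modeField_eq_zero {y : ℝ} (h : a y = 0) (x : ℝ) : modeField ℓ k a (x, y) = 0 := by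
  simp [modeField, h]

theorem lap_modeField (ha : ContDiff ℝ ∞ a) :
    lap (modeField ℓ k a) = modeField ℓ k (modeLap (wavenumber ℓ k) a) := by
  funext z
  rw [lap, dx_modeField ha, dx_modeField (by fun_prop), dy_modeField ha,
    dy_modeField (contDiff_deriv ha)]
  simp only [modeField, modeLap, iteratedDeriv_succ, iteratedDeriv_zero]
  linear_combination (wavenumber ℓ k : ℂ) ^ 2 * a z.2 * fourier k (z.1 : AddCircle ℓ)
    * Complex.I_sq

theorem modeCoeff_modeField (hℓ : 0 < ℓ) (j k : ℤ) (a : ℝ → ℂ) (y : ℝ) :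
    modeCoeff ℓ k (modeField ℓ j a) y = if j = k then a y else 0 := by
  have : Fact (0 < ℓ) := ⟨hℓ⟩
  have hcoeff := fourierCoeff_eq_intervalIntegral (T := ℓ) (fourier j) k 0
  rw [fourierCoeff_fourier, zero_add, Complex.real_smul, one_div, Complex.ofReal_inv] at hcoeff
  calc modeCoeff ℓ k (modeField ℓ j a) y
      = a y * modeCoeff ℓ k (fun z => fourier j (z.1 : AddCircle ℓ)) y :=
        congrFun (modeCoeff_mul_left a _) y
    _ = a y * Pi.single (M := fun _ => ℂ) j 1 k := congrArg (a y * ·) hcoeff.symm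
    _ = if j = k then a y else 0 := by simp [Pi.single_apply, eq_comm]

theorem integrable_cell {E : Type*} [NormedAddCommGroup E] {f : ℝ × ℝ → E} (hf : Continuous f) :
    Integrable f (cell ℓ) :=
  hf.continuousOn.integrableOn_compact (isCompact_Icc.prod isCompact_Icc)

theorem integral_cell_eq (hℓ : 0 ≤ ℓ) {f : ℝ × ℝ → ℝ} (hf : Continuous f) :
    ∫ z, f z ∂cell ℓ = ∫ y in (0 : ℝ)..1, ∫ x in (0 : ℝ)..ℓ, f (x, y) := by
  have hint : Integrable f (cell ℓ) := integrable_cell hf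
  rw [cell, Measure.volume_eq_prod, ← Measure.prod_restrict] at hint ⊢
  rw [integral_prod_symm _ hint, intervalIntegral.integral_of_le zero_le_one,
    integral_Icc_eq_integral_Ioc]
  simp only [intervalIntegral.integral_of_le hℓ, integral_Icc_eq_integral_Ioc]

theorem hasSum_sq_modeCoeff (hℓ : 0 < ℓ) (hf : Continuous f) (y : ℝ) :
    HasSum (fun k => ℓ * ‖modeCoeff ℓ k f y‖ ^ 2) (∫ x in (0 : ℝ)..ℓ, ‖f (x, y)‖ ^ 2) := by
  have hcoeff : ∀ k, fourierCoeffOn hℓ (fun x => f (x, y)) k = modeCoeff ℓ k f y := fun k => by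
    rw [fourierCoeffOn_eq_integral, sub_zero, one_div, Complex.real_smul, Complex.ofReal_inv]
    rfl
  have hmem : MemLp (fun x => f (x, y)) 2 (volume.restrict (Set.Ioc 0 ℓ)) := by
    rw [memLp_two_iff_integrable_sq_norm (by fun_prop)]
    exact (Continuous.intervalIntegrable (by fun_prop) 0 ℓ).1
  have h := (hasSum_sq_fourierCoeffOn hℓ hmem).mul_left ℓ
  simp only [hcoeff, sub_zero, smul_eq_mul] at h
  rwa [mul_inv_cancel_left₀ hℓ.ne'] at h

theorem hasSum_normSq_modeCoeff (hℓ : 0 < ℓ) (hf : Continuous f) :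
    HasSum (fun k => ℓ * normSq (modeCoeff ℓ k f)) (∫ z, ‖f z‖ ^ 2 ∂cell ℓ) := by
  have hslice := hasSum_sq_modeCoeff hℓ hf
  have hcont : Continuous fun y => ∫ x in (0 : ℝ)..ℓ, ‖f (x, y)‖ ^ 2 :=
    intervalIntegral.continuous_parametric_intervalIntegral_of_continuous'
      (by unfold Function.uncurry; fun_prop) 0 ℓ
  rw [integral_cell_eq hℓ.le (by fun_prop)]
  have := intervalIntegral.hasSum_integral_of_dominated_convergence (μ := volume)
    (a := 0) (b := 1) (F := fun k y => ℓ * ‖modeCoeff ℓ k f y‖ ^ 2)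
    (f := fun y => ∫ x in (0 : ℝ)..ℓ, ‖f (x, y)‖ ^ 2) (fun k y => ℓ * ‖modeCoeff ℓ k f y‖ ^ 2)
    (fun k => Continuous.aestronglyMeasurable (by fun_prop))
    (fun k => .of_forall fun y _ => by rw [Real.norm_of_nonneg (by positivity)])
    (.of_forall fun y _ => (hslice y).summable)
    (by simpa only [fun y => (hslice y).tsum_eq] using hcont.intervalIntegrable _ _)
    (.of_forall fun y _ => hslice y)
  simpa only [intervalIntegral.integral_const_mul, normSq] using this

end Fourier

/-! ### Square integrable fields and their Fourier series -/

section Represents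

variable {ℓ : ℝ} {h h' : L2 ℓ} {u v u' v' : ℝ × ℝ → ℂ}

theorem represents_zero (ℓ : ℝ) : Represents ℓ 0 (fun _ => 0) (fun _ => 0) := by
  filter_upwards [Lp.coeFn_zero (EuclideanSpace ℂ (Fin 2)) 2 (cell ℓ)] with z hz
  rw [hz]
  ext i
  fin_cases i <;> simp

theorem Represents.add (H : Represents ℓ h u v) (H' : Represents ℓ h' u' v') :
    Represents ℓ (h + h') (fun z => u z + u' z) (fun z => v z + v' z) := by
  filter_upwards [Lp.coeFn_add h h', H, H'] with z hz hw hw'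
  rw [hz, Pi.add_apply, hw, hw']
  ext i
  fin_cases i <;> simp

theorem Represents.const_smul (c : ℂ) (H : Represents ℓ h u v) :
    Represents ℓ (c • h) (fun z => c * u z) (fun z => c * v z) := by
  filter_upwards [Lp.coeFn_smul c h, H] with z hz hw
  rw [hz, Pi.smul_apply, hw]
  ext i
  fin_cases i <;> simp

theorem Represents.sub (H : Represents ℓ h u v) (H' : Represents ℓ h' u' v') :
    Represents ℓ (h - h') (fun z => u z - u' z) (fun z => v z - v' z) := by
  simpa only [neg_smul, one_smul, neg_mul, one_mul, ← sub_eq_add_neg] using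
    H.add (H'.const_smul (-1))

theorem represents_sum {ι : Type*} {d : ι → L2 ℓ} {a b : ι → ℝ × ℝ → ℂ}
    (H : ∀ i, Represents ℓ (d i) (a i) (b i)) (S : Finset ι) :
    Represents ℓ (∑ i ∈ S, d i) (fun z => ∑ i ∈ S, a i z) (fun z => ∑ i ∈ S, b i z) := by
  induction S using Finset.cons_induction with
  | empty => simpa only [Finset.sum_empty] using represents_zero ℓ
  | cons i S hi ih => simpa only [Finset.sum_cons] using (H i).add ih

theorem exists_represents (ℓ : ℝ) (hu : Continuous u) (hv : Continuous v) :
    ∃ h, Represents ℓ h u v := by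
  have hmem : MemLp (fun z => !₂[u z, v z]) 2 (cell ℓ) := by
    rw [memLp_two_iff_integrable_sq_norm (Continuous.aestronglyMeasurable (by fun_prop))]
    exact integrable_cell (by fun_prop)
  exact ⟨hmem.toLp _, hmem.coeFn_toLp⟩

theorem IsSmoothSolenoidal.mem_solenoidal (hw : IsSmoothSolenoidal ℓ u v)
    (H : Represents ℓ h u v) : h ∈ solenoidal ℓ :=
  Submodule.le_topologicalClosure _ (Submodule.subset_span ⟨u, v, hw, H⟩)

theorem Represents.norm_sq (H : Represents ℓ h u v) (hu : Continuous u) (hv : Continuous v) :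
    ‖h‖ ^ 2 = ∫ z, ‖u z‖ ^ 2 ∂cell ℓ + ∫ z, ‖v z‖ ^ 2 ∂cell ℓ := by
  have hnorm : ‖h‖ ^ 2 = ∫ z, ‖h z‖ ^ 2 ∂cell ℓ := by
    have := congr_arg RCLike.re (L2.inner_def (𝕜 := ℂ) h h)
    rw [← integral_re (L2.integrable_inner h h)] at this
    simpa only [← norm_sq_eq_re_inner] using this
  rw [hnorm, ← integral_add (integrable_cell (by fun_prop)) (integrable_cell (by fun_prop))]
  refine integral_congr_ae ?_
  filter_upwards [H] with z hz
  rw [hz, EuclideanSpace.norm_sq_eq, Fin.sum_univ_two]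
  rfl

theorem Represents.hasSum_normSq (hℓ : 0 < ℓ) (H : Represents ℓ h u v) (hu : Continuous u)
    (hv : Continuous v) :
    HasSum (fun k => ℓ * (normSq (modeCoeff ℓ k u) + normSq (modeCoeff ℓ k v))) (‖h‖ ^ 2) := by
  rw [H.norm_sq hu hv]
  simpa only [mul_add] using (hasSum_normSq_modeCoeff hℓ hu).add (hasSum_normSq_modeCoeff hℓ hv)

theorem continuous_modeField {k : ℤ} {a : ℝ → ℂ} (ha : Continuous a) :
    Continuous (modeField ℓ k a) :=
  (ha.comp continuous_snd).mul ((continuous_fourier ℓ k).comp continuous_fst)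

theorem modeCoeff_sum_modeField (hℓ : 0 < ℓ) {a : ℤ → ℝ → ℂ} (ha : ∀ k, Continuous (a k))
    (S : Finset ℤ) (j : ℤ) :
    modeCoeff ℓ j (fun z => ∑ k ∈ S, modeField ℓ k (a k) z)
      = fun y => if j ∈ S then a j y else 0 := by
  induction S using Finset.cons_induction with
  | empty => exact funext fun y => modeCoeff_eq_zero fun x => Finset.sum_empty
  | cons k S hk ih =>
    have hsum : Continuous fun z => ∑ k ∈ S, modeField ℓ k (a k) z :=
      continuous_finsetSum _ fun k _ => continuous_modeField (ha k)
    simp only [Finset.sum_cons]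
    rw [modeCoeff_add (continuous_modeField (ha k)) hsum, ih]
    funext y
    rw [modeCoeff_modeField hℓ]
    by_cases hkj : k = j
    · subst hkj
      simp [hk]
    · simp [hkj, Ne.symm hkj]

theorem normSq_modeCoeff_sub_sum (hℓ : 0 < ℓ) (hu : Continuous u) (S : Finset ℤ) (j : ℤ) :
    normSq (modeCoeff ℓ j fun z => u z - ∑ k ∈ S, modeField ℓ k (modeCoeff ℓ k u) z)
      = if j ∈ S then 0 else normSq (modeCoeff ℓ j u) := by
  have hcoeff (k : ℤ) : Continuous (modeCoeff ℓ k u) := continuous_modeCoeff hu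
  rw [modeCoeff_sub hu (continuous_finsetSum _ fun k _ => continuous_modeField (hcoeff k)),
    modeCoeff_sum_modeField hℓ hcoeff]
  split_ifs <;> simp [normSq]

theorem Represents.norm_sub_sum_sq (hℓ : 0 < ℓ) (H : Represents ℓ h u v) (hu : Continuous u)
    (hv : Continuous v) {d : ℤ → L2 ℓ} (hd : ∀ k, Represents ℓ (d k)
      (modeField ℓ k (modeCoeff ℓ k u)) (modeField ℓ k (modeCoeff ℓ k v))) (S : Finset ℤ) :
    ‖h - ∑ k ∈ S, d k‖ ^ 2
      = ‖h‖ ^ 2 - ∑ k ∈ S, ℓ * (normSq (modeCoeff ℓ k u) + normSq (modeCoeff ℓ k v)) := by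
  have hcont {f : ℝ × ℝ → ℂ} (hf : Continuous f) :
      Continuous fun z => f z - ∑ k ∈ S, modeField ℓ k (modeCoeff ℓ k f) z :=
    hf.sub (continuous_finsetSum _ fun k _ => continuous_modeField (continuous_modeCoeff hf))
  have htail := (H.sub (represents_sum hd S)).hasSum_normSq hℓ (hcont hu) (hcont hv)
  simp only [normSq_modeCoeff_sub_sum hℓ hu, normSq_modeCoeff_sub_sum hℓ hv] at htail
  have hhead : HasSum
      (fun k => if k ∈ S then ℓ * (normSq (modeCoeff ℓ k u) + normSq (modeCoeff ℓ k v)) else 0)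
      (∑ k ∈ S, ℓ * (normSq (modeCoeff ℓ k u) + normSq (modeCoeff ℓ k v))) := by
    simpa using hasSum_sum_of_ne_finset_zero (s := S) (L := .unconditional ℤ)
      (f := fun k => if k ∈ S then ℓ * (normSq (modeCoeff ℓ k u) + normSq (modeCoeff ℓ k v)) else 0)
      (fun k hk => if_neg hk)
  refine eq_sub_of_add_eq (((htail.add hhead).congr_fun fun k => ?_).unique
    (H.hasSum_normSq hℓ hu hv))
  split_ifs <;> simp

theorem Represents.hasSum_modeField (hℓ : 0 < ℓ) (H : Represents ℓ h u v) (hu : Continuous u)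
    (hv : Continuous v) {d : ℤ → L2 ℓ} (hd : ∀ k, Represents ℓ (d k)
      (modeField ℓ k (modeCoeff ℓ k u)) (modeField ℓ k (modeCoeff ℓ k v))) : HasSum d h := by
  have hsq : Filter.Tendsto (fun S : Finset ℤ => ‖h - ∑ k ∈ S, d k‖ ^ 2) Filter.atTop (nhds 0) := by
    simp only [H.norm_sub_sum_sq hℓ hu hv hd]
    have hparseval := H.hasSum_normSq hℓ hu hv
    rw [HasSum, SummationFilter.unconditional_filter] at hparseval
    rw [← sub_self (‖h‖ ^ 2)]
    exact hparseval.const_sub (‖h‖ ^ 2)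
  refine tendsto_iff_norm_sub_tendsto_zero.mpr ?_
  simpa [norm_sub_rev] using hsq.sqrt

end Represents

/-! ### Stream functions -/

section StreamFunction

variable {ℓ : ℝ} {Ψ : ℝ × ℝ → ℂ}

theorem divergence_stream (hΨ : ContDiff ℝ ∞ Ψ) :
    divergence (fun z => -dy Ψ z) (dx Ψ) = fun _ => 0 := by
  funext z
  rw [divergence, dx_neg, dx_dy_comm hΨ, neg_add_cancel]

theorem vorticity_stream (Ψ : ℝ × ℝ → ℂ) : vorticity (fun z => -dy Ψ z) (dx Ψ) = lap Ψ := by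
  funext z
  rw [vorticity, dy_neg, sub_neg_eq_add, lap]

theorem isSmoothSolenoidal_stream (hΨ : ContDiff ℝ ∞ Ψ) (hper : ∀ x y, Ψ (x + ℓ, y) = Ψ (x, y))
    (h0 : ∀ x, Ψ (x, 0) = 0) (h1 : ∀ x, Ψ (x, 1) = 0) :
    IsSmoothSolenoidal ℓ (fun z => -dy Ψ z) (dx Ψ) where
  smooth_u := by fun_prop
  smooth_v := by fun_prop
  periodic_u x y := by rw [dy_periodic (c := 0) (by simpa using hper)]
  periodic_v := dx_periodic (c := 0) (by simpa using hper)
  div_free x y _ := congrFun (divergence_stream hΨ) (x, y)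
  wall_zero := dx_eq_zero_of_forall_eq_zero hΨ h0
  wall_one := dx_eq_zero_of_forall_eq_zero hΨ h1
  flux_zero x := by
    rw [intervalIntegral.integral_neg, intervalIntegral.integral_eq_sub_of_hasDerivAt
      (fun y _ => hasDerivAt_snd hΨ x y) (Continuous.intervalIntegrable
        ((contDiff_dy hΨ).continuous.comp (by fun_prop)) _ _), h0, h1, sub_self, neg_zero]

end StreamFunction

/-! ### The Orr–Sommerfeld equation of a single mode -/

section OrrSommerfeld

variable {R κ : ℝ} {s : ℂ} {F G ψ : ℝ → ℂ}

/-- The vorticity of the Fourier mode `(F y, G y) e^{iκx}`. -/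
def modeVorticity (κ : ℝ) (F G : ℝ → ℂ) (y : ℝ) : ℂ := Complex.I * κ * G y - deriv F y

/-- The stream function of the Fourier mode with first component `F y e^{iκx}` that vanishes at
`y = 0`. -/
def modeStream (F : ℝ → ℂ) (y : ℝ) : ℂ := -∫ t in (0 : ℝ)..y, F t

/-- The left-hand side of the Orr–Sommerfeld equation, grouped as the vorticity equation for
`modeLap κ ψ`. -/
def orrSommerfeld (R κ : ℝ) (s : ℂ) (ψ : ℝ → ℂ) (y : ℝ) : ℂ :=
  (1 / R : ℂ) * modeLap κ (modeLap κ ψ) y - (s + Complex.I * κ * y) * modeLap κ ψ y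

theorem contDiff_iteratedDeriv (hψ : ContDiff ℝ ∞ ψ) (n : ℕ) :
    ContDiff ℝ ∞ (iteratedDeriv n ψ) := by
  rw [iteratedDeriv_eq_iterate]
  exact hψ.iterate_deriv n

theorem contDiff_modeLap (hψ : ContDiff ℝ ∞ ψ) : ContDiff ℝ ∞ (modeLap κ ψ) :=
  (contDiff_iteratedDeriv hψ 2).sub (contDiff_const.mul hψ)

theorem modeLap_modeLap (hψ : ContDiff ℝ ∞ ψ) (y : ℝ) :
    modeLap κ (modeLap κ ψ) y
      = iteratedDeriv 4 ψ y - 2 * (κ : ℂ) ^ 2 * iteratedDeriv 2 ψ y + (κ : ℂ) ^ 4 * ψ y := by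
  have hlap : iteratedDeriv 2 (modeLap κ ψ) y
      = iteratedDeriv 4 ψ y - (κ : ℂ) ^ 2 * iteratedDeriv 2 ψ y := by
    rw [show iteratedDeriv 4 ψ = iteratedDeriv 2 (iteratedDeriv 2 ψ) by
      simp only [iteratedDeriv_eq_iterate]; rfl]
    unfold modeLap
    rw [iteratedDeriv_fun_sub, iteratedDeriv_const_mul_field]
    · exact (contDiff_infty.mp (contDiff_iteratedDeriv hψ 2) 2).contDiffAt
    · exact (contDiff_infty.mp (contDiff_const.mul hψ) 2).contDiffAt
  rw [modeLap, hlap, modeLap]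
  ring

theorem orrSommerfeld_eq (hψ : ContDiff ℝ ∞ ψ) (y : ℝ) :
    orrSommerfeld R κ s ψ y = (1 / R : ℂ) * iteratedDeriv 4 ψ y
      - (s + 2 * (κ : ℂ) ^ 2 / R + Complex.I * κ * y) * iteratedDeriv 2 ψ y
      + (s * (κ : ℂ) ^ 2 + (κ : ℂ) ^ 4 / R + Complex.I * (κ : ℂ) ^ 3 * y) * ψ y := by
  rw [orrSommerfeld, modeLap_modeLap hψ, modeLap]
  ring

theorem modeLap_eqOn_Icc {f g : ℝ → ℂ} (hf : ContDiff ℝ ∞ f) (hg : ContDiff ℝ ∞ g)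
    (h : Set.EqOn f g (Set.Icc 0 1)) : Set.EqOn (modeLap κ f) (modeLap κ g) (Set.Icc 0 1) :=
  fun y hy => by
    rw [modeLap, modeLap, h hy, eqOn_iteratedDeriv (uniqueDiffOn_Icc zero_lt_one) hf hg h 2 hy]

theorem hasDerivAt_modeStream (hF : Continuous F) (y : ℝ) :
    HasDerivAt (modeStream F) (-F y) y :=
  (hF.integral_hasStrictDerivAt 0 y).hasDerivAt.neg

theorem deriv_modeStream (hF : Continuous F) : deriv (modeStream F) = fun y => -F y :=
  funext fun y => (hasDerivAt_modeStream hF y).deriv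

theorem contDiff_modeStream (hF : ContDiff ℝ ∞ F) : ContDiff ℝ ∞ (modeStream F) := by
  rw [contDiff_infty_iff_deriv, deriv_modeStream hF.continuous]
  exact ⟨fun y => (hasDerivAt_modeStream hF.continuous y).differentiableAt, hF.neg⟩

theorem IsSolenoidalMode.eqOn_modeStream (h : IsSolenoidalMode κ F G) :
    Set.EqOn G (fun y => Complex.I * κ * modeStream F y) (Set.Icc 0 1) := by
  intro y hy
  have hG : ∫ t in (0 : ℝ)..y, deriv G t = G y - G 0 :=
    intervalIntegral.integral_eq_sub_of_hasDerivAt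
      (fun t _ => (h.smooth_G.differentiable (by simp) t).hasDerivAt)
      ((h.smooth_G.continuous_deriv (by simp)).intervalIntegrable _ _)
  have hdiv : ∫ t in (0 : ℝ)..y, deriv G t = ∫ t in (0 : ℝ)..y, -(Complex.I * κ) * F t := by
    refine intervalIntegral.integral_congr fun t ht => ?_
    rw [Set.uIcc_of_le hy.1] at ht
    linear_combination h.div_free t ⟨ht.1, ht.2.trans hy.2⟩
  rw [hG, intervalIntegral.integral_const_mul, h.wall_zero] at hdiv
  simp only [modeStream]
  linear_combination hdiv

theorem IsSolenoidalMode.modeVorticity_eqOn (h : IsSolenoidalMode κ F G) :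
    Set.EqOn (modeVorticity κ F G) (modeLap κ (modeStream F)) (Set.Icc 0 1) := by
  intro y hy
  rw [modeVorticity, modeLap, h.eqOn_modeStream hy, iteratedDeriv_succ, iteratedDeriv_one,
    deriv_modeStream h.smooth_F.continuous, deriv.fun_neg]
  linear_combination (κ : ℂ) ^ 2 * modeStream F y * Complex.I_sq

end OrrSommerfeld

/-! ### Fourier modes of classical solutions -/

section ClassicalSolutions

variable {ℓ R C : ℝ} {k : ℤ} {s : ℂ} {u v p u' v' : ℝ × ℝ → ℂ}

theorem vorticity_const_mul_sub (hu : ContDiff ℝ ∞ u) (hv : ContDiff ℝ ∞ v)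
    (hu' : ContDiff ℝ ∞ u') (hv' : ContDiff ℝ ∞ v') (s : ℂ) :
    vorticity (fun z => s * u z - u' z) (fun z => s * v z - v' z)
      = fun z => s * vorticity u v z - vorticity u' v' z := by
  unfold vorticity
  simp (disch := fun_prop) only [dx_sub, dy_sub, dx_const_mul, dy_const_mul]
  exact funext fun z => by ring

theorem IsSmoothSolenoidal.const_mul_sub (h : IsSmoothSolenoidal ℓ u v)
    (h' : IsSmoothSolenoidal ℓ u' v') (s : ℂ) :
    IsSmoothSolenoidal ℓ (fun z => s * u z - u' z) (fun z => s * v z - v' z) := by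
  simpa only [zero_add, neg_mul, one_mul, ← sub_eq_add_neg] using
    (IsSmoothSolenoidal.zero.add_const_mul h s).add_const_mul h' (-1)

theorem IsSmoothSolenoidal.isSolenoidalMode (h : IsSmoothSolenoidal ℓ u v) (k : ℤ) :
    IsSolenoidalMode (wavenumber ℓ k) (modeCoeff ℓ k u) (modeCoeff ℓ k v) where
  smooth_F := contDiff_modeCoeff h.smooth_u
  smooth_G := contDiff_modeCoeff h.smooth_v
  div_free y hy := by
    have hdiv := modeCoeff_add (ℓ := ℓ) (k := k) (contDiff_dx h.smooth_u).continuous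
      (contDiff_dy h.smooth_v).continuous
    rw [modeCoeff_dx h.smooth_u h.periodic_u, ← deriv_modeCoeff h.smooth_v] at hdiv
    exact (congrFun hdiv y).symm.trans (modeCoeff_eq_zero fun x => h.div_free x y hy)
  wall_zero := modeCoeff_eq_zero h.wall_zero
  wall_one := modeCoeff_eq_zero h.wall_one
  flux_zero := integral_modeCoeff_eq_zero h.smooth_u.continuous h.flux_zero

theorem modeCoeff_vorticity (hu : ContDiff ℝ ∞ u) (hv : ContDiff ℝ ∞ v)
    (hper : ∀ x y, v (x + ℓ, y) = v (x, y)) : modeCoeff ℓ k (vorticity u v)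
      = modeVorticity (wavenumber ℓ k) (modeCoeff ℓ k u) (modeCoeff ℓ k v) := by
  unfold vorticity
  rw [modeCoeff_sub (contDiff_dx hv).continuous (contDiff_dy hu).continuous,
    modeCoeff_dx hv hper, ← deriv_modeCoeff hu]
  rfl

theorem IsSmoothSolenoidal.vorticity_periodic (h : IsSmoothSolenoidal ℓ u v) (x y : ℝ) :
    vorticity u v (x + ℓ, y) = vorticity u v (x, y) := by
  rw [vorticity, vorticity, dx_periodic (c := 0) (by simpa using h.periodic_v),
    dy_periodic (c := 0) (by simpa using h.periodic_u)]

theorem IsSmoothSolenoidal.modeCoeff_vorticity_forcing (h : IsSmoothSolenoidal ℓ u v)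
    (hp : ContDiff ℝ ∞ p) (s : ℂ) {y : ℝ} (hy : y ∈ Set.Icc (0 : ℝ) 1) :
    modeCoeff ℓ k (vorticity (fun z => s * u z - rhsU R u v p z)
        fun z => s * v z - rhsV R v p z) y
      = (s + Complex.I * wavenumber ℓ k * y) * modeCoeff ℓ k (vorticity u v) y
        - (1 / R : ℂ) * modeLap (wavenumber ℓ k) (modeCoeff ℓ k (vorticity u v)) y := by
  have hu := h.smooth_u
  have hv := h.smooth_v
  have hvort : ContDiff ℝ ∞ (vorticity u v) := contDiff_vorticity hu hv
  have hstrip (x : ℝ) : vorticity (fun z => s * u z - rhsU R u v p z)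
      (fun z => s * v z - rhsV R v p z) (x, y) = (s * vorticity u v (x, y)
        + y * dx (vorticity u v) (x, y)) - (1 / R : ℂ) * lap (vorticity u v) (x, y) := by
    rw [congrFun (vorticity_const_mul_sub hu hv (by fun_prop) (by fun_prop) s) (x, y),
      vorticity_rhs hu hv hp, show divergence u v (x, y) = 0 from h.div_free x y hy]
    ring
  rw [modeCoeff_congr (g := fun z => (s * vorticity u v z + z.2 * dx (vorticity u v) z)
      - (1 / R : ℂ) * lap (vorticity u v) z) hstrip,
    modeCoeff_sub (ContDiff.continuous (𝕜 := ℝ) (n := ∞) (by fun_prop))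
      (ContDiff.continuous (𝕜 := ℝ) (n := ∞) (by fun_prop)),
    modeCoeff_add (ContDiff.continuous (𝕜 := ℝ) (n := ∞) (by fun_prop))
      (ContDiff.continuous (𝕜 := ℝ) (n := ∞) (by fun_prop)),
    modeCoeff_mul_left (fun _ => s), modeCoeff_mul_left (fun y => (y : ℂ)),
    modeCoeff_mul_left (fun _ => (1 / R : ℂ)), modeCoeff_dx hvort h.vorticity_periodic,
    modeCoeff_lap hvort h.vorticity_periodic]
  ring

theorem IsPressure.isStreamSolution (hP : IsPressure ℓ R u v p) (h : IsSmoothSolenoidal ℓ u v)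
    (h0 : ∀ x, u (x, 0) = 0) (h1 : ∀ x, u (x, 1) = 0) (s : ℂ) (k : ℤ) :
    IsStreamSolution R (wavenumber ℓ k) s (modeCoeff ℓ k fun z => s * u z - rhsU R u v p z)
      (modeCoeff ℓ k fun z => s * v z - rhsV R v p z) (modeStream (modeCoeff ℓ k u)) where
  smooth := contDiff_modeStream (contDiff_modeCoeff h.smooth_u)
  ode y hy := by
    have hfg := h.const_mul_sub ((isPressure_iff h hP.smooth hP.periodic_grad).mp hP) s
    have hforcing := h.modeCoeff_vorticity_forcing (R := R) (k := k) hP.smooth s hy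
    have hmode := (h.isSolenoidalMode k).modeVorticity_eqOn
    rw [← modeCoeff_vorticity h.smooth_u h.smooth_v h.periodic_v] at hmode
    have hlap := modeLap_eqOn_Icc (κ := wavenumber ℓ k)
      (contDiff_modeCoeff (contDiff_vorticity h.smooth_u h.smooth_v))
      (contDiff_modeLap (contDiff_modeStream (contDiff_modeCoeff h.smooth_u))) hmode
    rw [modeCoeff_vorticity hfg.smooth_u hfg.smooth_v hfg.periodic_v, modeVorticity, hlap hy,
      hmode hy] at hforcing
    rw [← orrSommerfeld_eq (contDiff_modeStream (contDiff_modeCoeff h.smooth_u)), orrSommerfeld]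
    linear_combination hforcing
  zero_zero := by simp [modeStream]
  zero_one := by rw [modeStream, (h.isSolenoidalMode k).flux_zero, neg_zero]
  deriv_zero := by
    simp only [deriv_modeStream (continuous_modeCoeff h.smooth_u.continuous),
      modeCoeff_eq_zero h0, neg_zero]
  deriv_one := by
    simp only [deriv_modeStream (continuous_modeCoeff h.smooth_u.continuous),
      modeCoeff_eq_zero h1, neg_zero]

/-- The a priori estimates for the boundary value problems of all modes: the hypothesis under which
the resolvent is bounded. -/
def StreamEstimate (ℓ R C : ℝ) (s : ℂ) : Prop :=
  ∀ (k : ℤ) (F G ψ : ℝ → ℂ), IsSolenoidalMode (wavenumber ℓ k) F G →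
    IsStreamSolution R (wavenumber ℓ k) s F G ψ →
    wavenumber ℓ k ^ 2 * normSq ψ ≤ C * R ^ 2 * (normSq F + normSq G) ∧
      normSq (deriv ψ) ≤ C * R ^ 2 * (normSq F + normSq G)

theorem IsSolenoidalMode.normSq_eq {κ : ℝ} {F G : ℝ → ℂ} (h : IsSolenoidalMode κ F G) :
    normSq F = normSq (deriv (modeStream F)) ∧ normSq G = κ ^ 2 * normSq (modeStream F) := by
  constructor
  · simp only [normSq, deriv_modeStream h.smooth_F.continuous, norm_neg]
  · rw [normSq, normSq, ← intervalIntegral.integral_const_mul]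
    refine intervalIntegral.integral_congr fun y hy => ?_
    rw [Set.uIcc_of_le zero_le_one] at hy
    simp only [h.eqOn_modeStream hy, norm_mul, Complex.norm_I, one_mul, Complex.norm_real, mul_pow,
      Real.norm_eq_abs, sq_abs]

theorem StreamEstimate.norm_sq_le (hE : StreamEstimate ℓ R C s) (hℓ : 0 < ℓ)
    {q : solenoidal ℓ × solenoidal ℓ} (hq : q ∈ classicalGraph ℓ R) :
    ‖q.1‖ ^ 2 ≤ 2 * C * R ^ 2 * ‖s • q.1 - q.2‖ ^ 2 := by
  obtain ⟨u, v, p, h, h0, h1, hP, hw, hLw⟩ := hq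
  have hfg := h.const_mul_sub ((isPressure_iff h hP.smooth hP.periodic_grad).mp hP) s
  have hparseval := hw.hasSum_normSq hℓ h.smooth_u.continuous h.smooth_v.continuous
  have hparseval' := ((hw.const_smul s).sub hLw).hasSum_normSq hℓ hfg.smooth_u.continuous
    hfg.smooth_v.continuous
  refine hasSum_le (fun k => ?_) hparseval (hparseval'.mul_left (2 * C * R ^ 2))
  obtain ⟨hψ, hψ'⟩ := hE k _ _ _ (hfg.isSolenoidalMode k) (hP.isStreamSolution h h0 h1 s k)
  obtain ⟨hu, hv⟩ := (h.isSolenoidalMode k).normSq_eq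
  rw [hu, hv]
  calc _ ≤ ℓ * (2 * (C * R ^ 2 * _)) :=
        mul_le_mul_of_nonneg_left ((add_le_add hψ' hψ).trans_eq (two_mul _).symm) hℓ.le
    _ = _ := by ring

end ClassicalSolutions

/-! ### The range of the classical operator -/

section Range

variable {ℓ R C κ : ℝ} {k : ℤ} {s : ℂ} {f F G ψ : ℝ → ℂ}

theorem eqOn_zero_of_normSq_le_zero (hf : Continuous f) (h : normSq f ≤ 0) :
    Set.EqOn f 0 (Set.Icc 0 1) := by
  intro y hy
  by_contra hne
  exact h.not_gt <| intervalIntegral.integral_pos zero_lt_one (hf.norm.pow 2).continuousOn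
    (fun _ _ => by positivity) ⟨y, hy, pow_pos (norm_pos_iff.mpr hne) 2⟩

theorem StreamEstimate.eqOn_zero (hE : StreamEstimate ℓ R C s)
    (hψ : IsStreamSolution R (wavenumber ℓ k) s (fun _ => 0) (fun _ => 0) ψ) :
    Set.EqOn ψ 0 (Set.Icc 0 1) := by
  have hmode : IsSolenoidalMode (wavenumber ℓ k) (fun _ => 0) (fun _ => 0) :=
    ⟨contDiff_const, contDiff_const, by simp, rfl, rfl, by simp⟩
  have hderiv : Set.EqOn (deriv ψ) 0 (Set.Icc 0 1) :=
    eqOn_zero_of_normSq_le_zero (hψ.smooth.continuous_deriv (by simp)) <| by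
      simpa [normSq] using (hE k _ _ ψ hmode hψ).2
  intro y hy
  rw [Pi.zero_apply, ← hψ.zero_zero]
  refine constant_of_has_deriv_right_zero hψ.smooth.continuous.continuousOn (fun t ht => ?_) y hy
  exact ((hψ.smooth.differentiable (by simp) t).hasDerivAt.congr_deriv
    (hderiv (Set.Ico_subset_Icc_self ht))).hasDerivWithinAt

theorem IsClampedSolution.orrSommerfeld_eq (hR : R ≠ 0)
    (h : IsClampedSolution (fun y => R * (s + 2 * (κ : ℂ) ^ 2 / R + Complex.I * κ * y))
      (fun y => -R * (s * (κ : ℂ) ^ 2 + (κ : ℂ) ^ 4 / R + Complex.I * (κ : ℂ) ^ 3 * y))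
      (fun y => R * f y) ψ) (y : ℝ) : orrSommerfeld R κ s ψ y = f y := by
  have hR' : (R : ℂ) ≠ 0 := Complex.ofReal_ne_zero.mpr hR
  rw [Couette.orrSommerfeld_eq h.smooth, h.ode]
  field_simp
  ring

theorem IsClampedSolution.isStreamSolution (hR : R ≠ 0)
    (h : IsClampedSolution (fun y => R * (s + 2 * (κ : ℂ) ^ 2 / R + Complex.I * κ * y))
      (fun y => -R * (s * (κ : ℂ) ^ 2 + (κ : ℂ) ^ 4 / R + Complex.I * (κ : ℂ) ^ 3 * y))
      (fun y => R * (deriv F y - Complex.I * κ * G y)) ψ) : IsStreamSolution R κ s F G ψ where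
  smooth := h.smooth
  ode y _ := (Couette.orrSommerfeld_eq h.smooth y).symm.trans (h.orrSommerfeld_eq hR y)
  zero_zero := h.zero_zero
  zero_one := h.zero_one
  deriv_zero := h.deriv_zero
  deriv_one := h.deriv_one

theorem StreamEstimate.exists_isStreamSolution (hE : StreamEstimate ℓ R C s) (hR : R ≠ 0)
    (hF : ContDiff ℝ ∞ F) (hG : ContDiff ℝ ∞ G) :
    ∃ ψ, IsStreamSolution R (wavenumber ℓ k) s F G ψ ∧ ∀ y,
      orrSommerfeld R (wavenumber ℓ k) s ψ y = deriv F y - Complex.I * wavenumber ℓ k * G y := by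
  obtain ⟨ψ, hψ⟩ := exists_isClampedSolution
    (α := fun y => R * (s + 2 * (wavenumber ℓ k : ℂ) ^ 2 / R + Complex.I * wavenumber ℓ k * y))
    (β := fun y => -R * (s * (wavenumber ℓ k : ℂ) ^ 2 + (wavenumber ℓ k : ℂ) ^ 4 / R
      + Complex.I * (wavenumber ℓ k : ℂ) ^ 3 * y))
    (f := fun y => R * (deriv F y - Complex.I * wavenumber ℓ k * G y))
    (by fun_prop) (by fun_prop) (by fun_prop)
    fun ψ hψ => hE.eqOn_zero <| IsClampedSolution.isStreamSolution hR <| by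
      simpa [← Pi.zero_def] using hψ
  exact ⟨ψ, hψ.isStreamSolution hR, hψ.orrSommerfeld_eq hR⟩

theorem IsSolenoidalMode.isSmoothSolenoidal (h : IsSolenoidalMode (wavenumber ℓ k) F G) :
    IsSmoothSolenoidal ℓ (modeField ℓ k F) (modeField ℓ k G) where
  smooth_u := contDiff_modeField h.smooth_F
  smooth_v := contDiff_modeField h.smooth_G
  periodic_u := modeField_periodic ℓ k F
  periodic_v := modeField_periodic ℓ k G
  div_free x y hy := by
    rw [dx_modeField h.smooth_F, dy_modeField h.smooth_G]
    simp only [modeField]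
    rw [← add_mul, h.div_free y hy, zero_mul]
  wall_zero := modeField_eq_zero h.wall_zero
  wall_one := modeField_eq_zero h.wall_one
  flux_zero x := by
    simp only [modeField]
    rw [intervalIntegral.integral_mul_const, h.flux_zero, zero_mul]

theorem vorticity_modeField (hF : ContDiff ℝ ∞ F) (hG : ContDiff ℝ ∞ G) :
    vorticity (modeField ℓ k F) (modeField ℓ k G)
      = modeField ℓ k (modeVorticity (wavenumber ℓ k) F G) := by
  funext z
  rw [vorticity, dx_modeField hG, dy_modeField hF]
  simp only [modeField, modeVorticity]
  ring

theorem vorticity_rhs_stream_modeField (hψ : ContDiff ℝ ∞ ψ) (s : ℂ) (z : ℝ × ℝ) :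
    vorticity (rhsU R (fun z => -dy (modeField ℓ k ψ) z) (dx (modeField ℓ k ψ)) 0)
        (rhsV R (dx (modeField ℓ k ψ)) 0) z
      = s * modeField ℓ k (modeLap (wavenumber ℓ k) ψ) z
        + modeField ℓ k (orrSommerfeld R (wavenumber ℓ k) s ψ) z := by
  have hΨ : ContDiff ℝ ∞ (modeField ℓ k ψ) := contDiff_modeField hψ
  have hlap := contDiff_modeLap (κ := wavenumber ℓ k) hψ
  have h0 : ContDiff ℝ ∞ (0 : ℝ × ℝ → ℂ) := contDiff_const
  rw [vorticity_rhs (contDiff_dy hΨ).neg (contDiff_dx hΨ) h0, vorticity_stream,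
    divergence_stream hΨ, lap_modeField hψ, lap_modeField hlap, dx_modeField hlap]
  simp only [modeField, orrSommerfeld]
  ring

theorem StreamEstimate.exists_mem_classicalGraph (hE : StreamEstimate ℓ R C s) (hR : R ≠ 0)
    (hFG : IsSolenoidalMode (wavenumber ℓ k) F G) {h : solenoidal ℓ}
    (H : Represents ℓ h (modeField ℓ k F) (modeField ℓ k G)) :
    ∃ q ∈ classicalGraph ℓ R, s • q.1 - q.2 = h := by
  obtain ⟨ψ, hψ, hode⟩ := hE.exists_isStreamSolution (k := k) hR hFG.smooth_F hFG.smooth_G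
  set Ψ : ℝ × ℝ → ℂ := modeField ℓ k ψ with hΨ_def
  have hΨ : ContDiff ℝ ∞ Ψ := contDiff_modeField hψ.smooth
  have hw : IsSmoothSolenoidal ℓ (fun z => -dy Ψ z) (dx Ψ) :=
    isSmoothSolenoidal_stream hΨ (modeField_periodic ℓ k ψ) (modeField_eq_zero hψ.zero_zero)
      (modeField_eq_zero hψ.zero_one)
  have hmode := hFG.isSmoothSolenoidal
  obtain ⟨p, hP, hU, hV⟩ := exists_isPressure_of_vorticity_eq (R := R) hw
    (hw.const_mul_sub hmode s) <| by
      funext z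
      rw [vorticity_const_mul_sub hw.smooth_u hw.smooth_v hmode.smooth_u hmode.smooth_v,
        vorticity_rhs_stream_modeField hψ.smooth s, vorticity_stream, hΨ_def,
        lap_modeField hψ.smooth, vorticity_modeField hFG.smooth_F hFG.smooth_G]
      simp only [modeField, hode, modeVorticity]
      ring
  obtain ⟨w, hwr⟩ := exists_represents ℓ hw.smooth_u.continuous hw.smooth_v.continuous
  refine ⟨(⟨w, hw.mem_solenoidal hwr⟩, s • ⟨w, hw.mem_solenoidal hwr⟩ - h),
    ⟨fun z => -dy Ψ z, dx Ψ, p, hw, fun x => ?_, fun x => ?_, hP, hwr, ?_⟩, sub_sub_cancel _ _⟩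
  · simp only [hΨ_def, dy_modeField hψ.smooth, modeField_eq_zero hψ.deriv_zero, neg_zero]
  · simp only [hΨ_def, dy_modeField hψ.smooth, modeField_eq_zero hψ.deriv_one, neg_zero]
  · rw [hU, hV]
    exact (hwr.const_smul s).sub H

end Range

/-! ### Density of the range -/

section DenseRange

variable {ℓ R C : ℝ} {s : ℂ}

theorem zero_mem_classicalGraph (ℓ R : ℝ) : 0 ∈ classicalGraph ℓ R := by
  have hU : rhsU R (fun _ => 0) (fun _ => 0) (fun _ => 0) = fun _ => 0 := by
    unfold rhsU lap advU dx dy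
    simp
  have hV : rhsV R (fun _ => 0) (fun _ => 0) = fun _ => 0 := by
    unfold rhsV lap advV dx dy
    simp
  refine ⟨_, _, fun _ => 0, IsSmoothSolenoidal.zero, fun _ => rfl, fun _ => rfl,
    (isPressure_iff .zero contDiff_const ⟨0, by simp⟩).mpr ?_, represents_zero ℓ, ?_⟩
  · rw [hU, hV]
    exact .zero
  · rw [hU, hV]
    exact represents_zero ℓ

theorem add_smul_mem_classicalGraph {q r : solenoidal ℓ × solenoidal ℓ}
    (hq : q ∈ classicalGraph ℓ R) (hr : r ∈ classicalGraph ℓ R) (c : ℂ) :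
    q + c • r ∈ classicalGraph ℓ R := by
  obtain ⟨u, v, p, h, h0, h1, hP, hw, hL⟩ := hq
  obtain ⟨u', v', p', h', h0', h1', hP', hw', hL'⟩ := hr
  refine ⟨_, _, _, h.add_const_mul h' c, fun x => ?_, fun x => ?_, hP.add_const_mul hP' h h' c,
    hw.add (hw'.const_smul c), ?_⟩
  · rw [h0, h0', mul_zero, add_zero]
  · rw [h1, h1', mul_zero, add_zero]
  · rw [rhsU_add_const_mul h.smooth_u hP.smooth h'.smooth_u hP'.smooth,
      rhsV_add_const_mul h.smooth_v hP.smooth h'.smooth_v hP'.smooth]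
    exact hL.add (hL'.const_smul c)

/-- The graph of the classical operator as a linear subspace. -/
def classicalSubmodule (ℓ R : ℝ) : Submodule ℂ (solenoidal ℓ × solenoidal ℓ) where
  carrier := classicalGraph ℓ R
  zero_mem' := zero_mem_classicalGraph ℓ R
  add_mem' hq hr := by simpa only [one_smul] using add_smul_mem_classicalGraph hq hr 1
  smul_mem' c q hq := by
    simpa only [zero_add] using add_smul_mem_classicalGraph (zero_mem_classicalGraph ℓ R) hq c

theorem StreamEstimate.dense_range (hE : StreamEstimate ℓ R C s) (hℓ : 0 < ℓ) (hR : R ≠ 0) :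
    Dense {h : solenoidal ℓ | ∃ q ∈ classicalSubmodule ℓ R, s • q.1 - q.2 = h} := by
  let T : solenoidal ℓ × solenoidal ℓ →ₗ[ℂ] solenoidal ℓ :=
    s • LinearMap.fst ℂ (solenoidal ℓ) (solenoidal ℓ) - LinearMap.snd ℂ _ _
  let range : Submodule ℂ (L2 ℓ) := ((classicalSubmodule ℓ R).map T).map (solenoidal ℓ).subtype
  have hle : solenoidal ℓ ≤ range.topologicalClosure := by
    refine Submodule.topologicalClosure_minimal _ (Submodule.span_le.mpr ?_)
      range.isClosed_topologicalClosure
    rintro h ⟨u, v, hw, H⟩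
    have hmode (k : ℤ) := (hw.isSolenoidalMode k).isSmoothSolenoidal
    choose d hd using fun k => exists_represents ℓ (hmode k).smooth_u.continuous
      (hmode k).smooth_v.continuous
    have hmem (k : ℤ) : d k ∈ range := by
      obtain ⟨q, hq, hqd⟩ := hE.exists_mem_classicalGraph hR (hw.isSolenoidalMode k)
        (h := ⟨d k, (hmode k).mem_solenoidal (hd k)⟩) (hd k)
      exact ⟨_, ⟨q, hq, hqd⟩, rfl⟩
    exact mem_closure_of_tendsto
      (H.hasSum_modeField hℓ hw.smooth_u.continuous hw.smooth_v.continuous hd)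
      (.of_forall fun S => range.sum_mem fun k _ => hmem k)
  exact Subtype.dense_iff.mpr hle

end DenseRange

end Couette

end

theorem lemma2_general (ℓ R C : ℝ) (hℓ : 0 < ℓ) (hR : R ≠ 0) (hC : 0 ≤ C) (s : ℂ)
    (hE : Couette.StreamEstimate ℓ R C s) :
    ∃ S : Couette.solenoidal ℓ →L[ℂ] Couette.solenoidal ℓ,
      Couette.IsResolvent (Couette.operatorGraph ℓ R) s S ∧ ‖S‖ ^ 2 ≤ 2 * C * R ^ 2 := by
  have hM : 0 ≤ 2 * C * R ^ 2 := by positivity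
  have : CompleteSpace (Couette.solenoidal ℓ) :=
    (Submodule.isClosed_topologicalClosure _).completeSpace_coe
  have hbound : ∀ q ∈ Couette.classicalSubmodule ℓ R,
      ‖q.1‖ ≤ √(2 * C * R ^ 2) * ‖s • q.1 - q.2‖ := fun q hq => by
    have h := Real.le_sqrt_of_sq_le (hE.norm_sq_le hℓ hq)
    rwa [Real.sqrt_mul hM, Real.sqrt_sq (norm_nonneg _)] at h
  obtain ⟨S, hS, hnorm⟩ :=
    Couette.exists_isResolvent_closure (Real.sqrt_nonneg _) hbound (hE.dense_range hℓ hR)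
  exact ⟨S, hS, (Real.le_sqrt (norm_nonneg S) hM).mp hnorm⟩

theorem lemma2 (ℓ R C : ℝ) (hℓ : 0 < ℓ) (hR : 0 < R) (hC : 0 ≤ C)
    (s : ℂ) (hs : ‖s‖ < 2 * Real.sqrt 2 * (1 + Real.sqrt R))
    (hψ : ∀ (k : ℤ) (F G ψ : ℝ → ℂ),
      Couette.IsSolenoidalMode (Couette.wavenumber ℓ k) F G →
      Couette.IsStreamSolution R (Couette.wavenumber ℓ k) s F G ψ →
      Couette.wavenumber ℓ k ^ 2 * Couette.normSq ψ
          ≤ C * R ^ 2 * (Couette.normSq F + Couette.normSq G) ∧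
        Couette.normSq (deriv ψ)
          ≤ C * R ^ 2 * (Couette.normSq F + Couette.normSq G)) :
    ∃ S : Couette.solenoidal ℓ →L[ℂ] Couette.solenoidal ℓ,
      Couette.IsResolvent (Couette.operatorGraph ℓ R) s S ∧ ‖S‖ ^ 2 ≤ 2 * C * R ^ 2 :=
  lemma2_general ℓ R C hℓ hR.ne' hC s hψ
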